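/- Let $M$ be a smooth manifold with global coordinates, identified with $\mathbb{R}^n$, with a smooth Riemannian structure $g=(g_{ij})$ and a smooth Poisson structure given by a bivector field $\beta=(\beta^{ij})$ (skew-symmetric, with $\beta^{il}\partial_l\beta^{jk}+\beta^{jl}\partial_l\beta^{ki}+\beta^{kl}\partial_l\beta^{ij}=0$). Write $\{f,h\}=\beta^{ij}\,\partial_i f\,\partial_j h$ for the Poisson bracket on $M$, $X_f=\{\cdot,f\}$ for the Hamiltonian vector field of $f$, and $\operatorname{grad} f=g^{ij}\partial_j f\,\partial_i$. Let $\mathcal P(M)$ be the set of probability measures on $M$. For $q\in\mathcal P(M)$ let $L^2_q(M)$ be the Hilbert space of (a.e. classes of) vector fields $X$ with $\mathbb{E}_q[g(X,X)]<\infty$ and inner product $\mathbb{E}_q[g(X,Y)]$, let $T_q\mathcal P(M)\subseteq L^2_q(M)$ be the closure of $\{\operatorname{grad} f: f\in C_c^\infty(M)\}$, and let $\pi_q:L^2_q(M)\to T_q\mathcal P(M)$ be the orthogonal projection. A function $F$ on $\mathcal P(M)$ has gradient $v=\operatorname{grad}F(q)\in T_q\mathcal P(M)$ at $q$ if, for every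 smooth family of maps $\varphi_t:M\to M$ with $\varphi_0=\mathrm{id}$ and $\varphi_t=\mathrm{id}$ outside a compact set independent of $t$, with initial velocity field $X=\frac{d}{dt}\varphi_t|_{t=0}$, the function $t\mapsto F((\varphi_t)_\#q)$ has derivative $\langle v,\pi_q(X)\rangle_{L^2_q}$ at $t=0$. A linearization of $F$ at $q$ is a linear function $F_f:\mu\mapsto\mathbb{E}_\mu[f]$, with $f$ smooth and $q$-integrable, such that $F_f$ and $F$ have gradients at $q$ and these are equal. The induced Poisson bracket on $\mathcal P(M)$ is $\{F,H\}(q)=F_{\{f,h\}}(q)=\mathbb{E}_q[\{f,h\}]$, where $F_f,F_h$ are linearizations of $F,H$ at $q$ and $\{f,h\}$ is $q$-integrable. For $F$ with a linearization at $q$, a vector $V\in T_q\mathcal P(M)$ is the Hamiltonian vector field of $F$ at $q$, written $V=\mathcal X_F(q)$, if $\langle\operatorname{grad}G(q),V\rangle_{L^2_q}=\{G,F\}(q)$ for every $G$ that has a gradient at $q$ and a Poisson bracket with $F$ at $q$. Let $p,q\in\mathcal P(M)$ have smooth positive densities with respect to Lebesgue measure in the coordinates (also denoted $p,q$), and suppose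 that $\mathrm{KL}(q\,\|\,p)<\infty$ and that $\operatorname{grad}\log(q/p)$ and $\beta^{ij}\partial_j\log(q/p)\,\partial_i$ belong to $L^2_q(M)$. Suppose also that $(M,g)$ is complete or that $\operatorname{grad}\log(q/p)\in T_q\mathcal P(M)$. Then the function $\mathrm{KL}_p:\mu\mapsto\mathrm{KL}(\mu\,\|\,p)=\int_M\log(\mu/p)\,d\mu$ has exactly one Hamiltonian vector at $q$, and $$\mathcal X_{\mathrm{KL}_p}(q)=\pi_q\big(X_{\log(q/p)}\big)=\pi_q\big(\beta^{ij}\,\partial_j\log(q/p)\,\partial_i\big).$$ -/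

import Mathlib

open MeasureTheory
open scoped ContDiff ENNReal NNReal Manifold

namespace WassersteinPoisson

/-- The coordinate space of a manifold that is globally diffeomorphic to `ℝⁿ`. -/
abbrev Coord (n : ℕ) : Type := EuclideanSpace ℝ (Fin n)

/-- The coordinate derivative `∂ⱼ f`. -/
noncomputable def partialDeriv {n : ℕ} (j : Fin n) (f : Coord n → ℝ) (x : Coord n) : ℝ :=
  fderiv ℝ f x (EuclideanSpace.single j 1)

/-- A smooth Riemannian structure in global coordinates: the matrix field `(gᵢⱼ)`. -/
structure RiemannianStructure (n : ℕ) where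
  /-- the coordinate matrix `(gᵢⱼ(x))` -/
  coeff : Coord n → Matrix (Fin n) (Fin n) ℝ
  smooth : ∀ i j, ContDiff ℝ ∞ fun x => coeff x i j
  posDef : ∀ x, (coeff x).PosDef

/-- A smooth Poisson structure in global coordinates, given by its bivector field `(βⁱʲ)`. -/
structure PoissonStructure (n : ℕ) where
  /-- the coordinate matrix `(βⁱʲ(x))` -/
  coeff : Coord n → Matrix (Fin n) (Fin n) ℝ
  smooth : ∀ i j, ContDiff ℝ ∞ fun x => coeff x i j
  skew : ∀ x i j, coeff x i j = -coeff x j i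
  jacobi : ∀ x i j k,
    ∑ l, (coeff x i l * partialDeriv l (fun y => coeff y j k) x
        + coeff x j l * partialDeriv l (fun y => coeff y k i) x
        + coeff x k l * partialDeriv l (fun y => coeff y i j) x) = 0

namespace PoissonStructure

variable {n : ℕ} (β : PoissonStructure n)

/-- The Poisson bracket `{f, h} = β(df, dh) = βⁱʲ ∂ᵢf ∂ⱼh` on the manifold. -/
noncomputable def bracket (f h : Coord n → ℝ) (x : Coord n) : ℝ :=
  ∑ i, ∑ j, β.coeff x i j * partialDeriv i f x * partialDeriv j h x

/-- The vector field `βⁱʲ ∂ⱼf ∂ᵢ`. -/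
noncomputable def coordField (f : Coord n → ℝ) (x : Coord n) : Coord n :=
  WithLp.toLp 2 fun i => ∑ j, β.coeff x i j * partialDeriv j f x

/-- `X` is the Hamiltonian vector field `X_f = {·, f}` of `f` on the manifold: as a derivation
on smooth functions it is `h ↦ {h, f}`. -/
def IsHamiltonianField (f : Coord n → ℝ) (X : Coord n → Coord n) : Prop :=
  ∀ h : Coord n → ℝ, ContDiff ℝ ∞ h → ∀ x, fderiv ℝ h x (X x) = β.bracket h f x

end PoissonStructure

namespace RiemannianStructure

variable {n : ℕ} (g : RiemannianStructure n)

/-- The inner product `gₓ(u, v) = gᵢⱼ(x) uⁱ vʲ` of tangent vectors at `x`. -/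
noncomputable def ip (x u v : Coord n) : ℝ :=
  ∑ i, ∑ j, g.coeff x i j * u i * v j

/-- The gradient `grad f = gⁱʲ ∂ⱼf ∂ᵢ`. -/
noncomputable def grad (f : Coord n → ℝ) (x : Coord n) : Coord n :=
  WithLp.toLp 2 fun i => ∑ j, (g.coeff x)⁻¹ i j * partialDeriv j f x

/-- The geodesic distance of `g`: the infimum of the `g`-lengths of `C¹` paths. -/
noncomputable def edist (x y : Coord n) : ℝ≥0∞ :=
  @Manifold.riemannianEDist (Coord n) _ _ (Coord n) _ 𝓘(ℝ, Coord n) (Coord n) _ _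
    (fun z => ⟨fun v => ENNReal.ofReal (√(g.ip z v v))⟩) x y

/-- Completeness of `(M, g)`, in the form of the Heine-Borel property: sets that are bounded for
the geodesic distance are relatively compact (equivalent to metric and to geodesic completeness by
the Hopf-Rinow theorem). -/
def IsComplete : Prop :=
  ∀ R : ℝ≥0, Bornology.IsBounded {x : Coord n | g.edist 0 x ≤ R}

lemma ip_comm (x u v : Coord n) : g.ip x u v = g.ip x v u := by
  unfold ip
  rw [Finset.sum_comm]
  refine Finset.sum_congr rfl fun i _ => Finset.sum_congr rfl fun j _ => ?_
  have h := (g.posDef x).isHermitian.apply i j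
  simp only [star_trivial] at h
  rw [h]; ring

lemma ip_add_left (x u v w : Coord n) : g.ip x (u + v) w = g.ip x u w + g.ip x v w := by
  unfold ip
  simp only [← Finset.sum_add_distrib, PiLp.add_apply]
  refine Finset.sum_congr rfl fun i _ => Finset.sum_congr rfl fun j _ => ?_
  ring

lemma ip_smul_left (x : Coord n) (c : ℝ) (u w : Coord n) :
    g.ip x (c • u) w = c * g.ip x u w := by
  unfold ip
  simp only [Finset.mul_sum, PiLp.smul_apply, smul_eq_mul]
  refine Finset.sum_congr rfl fun i _ => Finset.sum_congr rfl fun j _ => ?_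
  ring

lemma ip_add_right (x u v w : Coord n) : g.ip x w (u + v) = g.ip x w u + g.ip x w v := by
  rw [ip_comm, ip_add_left, ip_comm _ _ u, ip_comm _ _ v]

lemma ip_smul_right (x : Coord n) (c : ℝ) (u w : Coord n) :
    g.ip x w (c • u) = c * g.ip x w u := by
  rw [ip_comm, ip_smul_left, ip_comm _ _ u]

lemma ip_eq_dotProduct (x u v : Coord n) :
    g.ip x u v = dotProduct u.ofLp ((g.coeff x).mulVec v.ofLp) := by
  unfold ip dotProduct Matrix.mulVec dotProduct
  refine Finset.sum_congr rfl fun i _ => ?_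
  rw [Finset.mul_sum]
  refine Finset.sum_congr rfl fun j _ => ?_
  ring

lemma ip_self_pos (x : Coord n) {u : Coord n} (hu : u ≠ 0) : 0 < g.ip x u u := by
  rw [ip_eq_dotProduct]
  have h := (g.posDef x).dotProduct_mulVec_pos (x := u.ofLp)
    (fun h => hu (by ext i; simpa using congrFun h i))
  simpa using h

lemma ip_self_nonneg (x u : Coord n) : 0 ≤ g.ip x u u := by
  by_cases hu : u = 0
  · subst hu; simp [ip]
  · exact (g.ip_self_pos x hu).le

lemma ip_add_self_le (x u v : Coord n) :
    g.ip x (u + v) (u + v) ≤ 2 * g.ip x u u + 2 * g.ip x v v := by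
  have h := g.ip_self_nonneg x (u + (-1 : ℝ) • v)
  simp only [ip_add_left, ip_add_right, ip_smul_left, ip_smul_right] at h ⊢
  linarith

lemma abs_ip_le (x u v : Coord n) : |g.ip x u v| ≤ g.ip x u u + g.ip x v v := by
  have h := g.ip_self_nonneg x (u + (-1 : ℝ) • v)
  have h' := g.ip_self_nonneg x (u + v)
  have hu := g.ip_self_nonneg x u
  have hv := g.ip_self_nonneg x v
  have hc := g.ip_comm x u v
  simp only [ip_add_left, ip_add_right, ip_smul_left, ip_smul_right] at h h'
  rw [abs_le]
  constructor <;> linarith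

lemma continuous_coeff (i j : Fin n) : Continuous fun x => g.coeff x i j :=
  (g.smooth i j).continuous

lemma continuous_ip : Continuous fun z : Coord n × Coord n × Coord n => g.ip z.1 z.2.1 z.2.2 := by
  unfold ip
  refine continuous_finsetSum _ fun i _ => continuous_finsetSum _ fun j _ => ?_
  have := g.continuous_coeff i j
  fun_prop

lemma aestronglyMeasurable_ip {q : Measure (Coord n)} {X Y : Coord n → Coord n}
    (hX : AEStronglyMeasurable X q) (hY : AEStronglyMeasurable Y q) :
    AEStronglyMeasurable (fun x => g.ip x (X x) (Y x)) q := by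
  have hc : ∀ (Z : Coord n → Coord n) (i : Fin n), AEStronglyMeasurable Z q →
      AEStronglyMeasurable (fun x => Z x i) q := fun Z i hZ =>
    (PiLp.continuous_apply 2 _ i).comp_aestronglyMeasurable hZ
  have h : ∀ i j, AEStronglyMeasurable (fun x => g.coeff x i j * X x i * Y x j) q := fun i j =>
    ((g.continuous_coeff i j).aestronglyMeasurable.mul (hc X i hX)).mul (hc Y j hY)
  unfold ip
  exact Finset.aestronglyMeasurable_fun_sum _ fun i _ =>
    Finset.aestronglyMeasurable_fun_sum _ fun j _ => h i j

/-- `X` is a vector field with `E_q[g(X, X)] < ∞`. -/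
def MemL2 (q : Measure (Coord n)) (X : Coord n → Coord n) : Prop :=
  AEStronglyMeasurable X q ∧ Integrable (fun x => g.ip x (X x) (X x)) q

lemma MemL2.integrable_ip {g : RiemannianStructure n} {q : Measure (Coord n)}
    {X Y : Coord n → Coord n} (hX : g.MemL2 q X) (hY : g.MemL2 q Y) :
    Integrable (fun x => g.ip x (X x) (Y x)) q := by
  refine (hX.2.add hY.2).mono' (g.aestronglyMeasurable_ip hX.1 hY.1) ?_
  filter_upwards with x
  exact g.abs_ip_le x _ _

lemma memL2_of_hasCompactSupport (q : Measure (Coord n)) [IsFiniteMeasure q]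
    {X : Coord n → Coord n} (hX : Continuous X) (hc : HasCompactSupport X) : g.MemL2 q X := by
  refine ⟨hX.aestronglyMeasurable, ?_⟩
  refine Continuous.integrable_of_hasCompactSupport
    (g.continuous_ip.comp (continuous_id.prodMk (hX.prodMk hX))) ?_
  refine hc.mono ?_
  intro x hx h0
  apply hx
  simp [ip, h0]

/-- The a.e. classes of square-integrable vector fields, as a linear subspace. -/
def l2Submodule (q : Measure (Coord n)) : Submodule ℝ (Coord n →ₘ[q] Coord n) where
  carrier := {X | Integrable (fun x => g.ip x (X x) (X x)) q}
  zero_mem' := by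
    refine (integrable_zero (Coord n) ℝ q).congr ?_
    filter_upwards [AEEqFun.coeFn_zero (α := Coord n) (β := Coord n) (μ := q)] with x hx
    simp [hx, ip]
  add_mem' := by
    intro X Y hX hY
    refine Integrable.mono' ((hX.const_mul 2).add (hY.const_mul 2))
      (g.aestronglyMeasurable_ip (X + Y).aestronglyMeasurable (X + Y).aestronglyMeasurable) ?_
    filter_upwards [AEEqFun.coeFn_add X Y] with x hx
    rw [hx, Real.norm_of_nonneg (g.ip_self_nonneg x _)]
    exact g.ip_add_self_le x _ _
  smul_mem' := by
    intro c X hX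
    refine (Integrable.const_mul hX (c * c)).congr ?_
    filter_upwards [AEEqFun.coeFn_smul c X] with x hx
    rw [hx]
    simp only [Pi.smul_apply, ip_smul_left, ip_smul_right]
    ring

end RiemannianStructure

/-- The space `L²_q(M)` of (a.e. classes of) vector fields `X` with `E_q[g(X, X)] < ∞`. -/
def L2Field {n : ℕ} (g : RiemannianStructure n) (q : Measure (Coord n)) : Type :=
  g.l2Submodule q

namespace L2Field

variable {n : ℕ} (g : RiemannianStructure n) (q : Measure (Coord n))

noncomputable instance : AddCommGroup (L2Field g q) :=
  inferInstanceAs (AddCommGroup (g.l2Submodule q))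

noncomputable instance : Module ℝ (L2Field g q) :=
  inferInstanceAs (Module ℝ (g.l2Submodule q))

variable {g q}

/-- A representative of an element of `L²_q(M)`. -/
noncomputable def fn (X : L2Field g q) : Coord n → Coord n := X.1

/-- The element of `L²_q(M)` given by a square-integrable vector field. -/
noncomputable def mk (X : Coord n → Coord n) (hX : g.MemL2 q X) : L2Field g q :=
  ⟨AEEqFun.mk X hX.1, by
    refine hX.2.congr ?_
    filter_upwards [AEEqFun.coeFn_mk X hX.1] with x hx
    rw [hx]⟩

lemma memL2_fn (X : L2Field g q) : g.MemL2 q X.fn := ⟨X.1.aestronglyMeasurable, X.2⟩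

lemma fn_mk (X : Coord n → Coord n) (hX : g.MemL2 q X) : (mk X hX).fn =ᵐ[q] X :=
  AEEqFun.coeFn_mk X hX.1

lemma fn_add (X Y : L2Field g q) : (X + Y).fn =ᵐ[q] X.fn + Y.fn := AEEqFun.coeFn_add X.1 Y.1

lemma fn_sub (X Y : L2Field g q) : (X - Y).fn =ᵐ[q] X.fn - Y.fn := AEEqFun.coeFn_sub X.1 Y.1

lemma fn_smul (c : ℝ) (X : L2Field g q) : (c • X).fn =ᵐ[q] c • X.fn := AEEqFun.coeFn_smul c X.1

lemma ext_fn {X Y : L2Field g q} (h : X.fn =ᵐ[q] Y.fn) : X = Y := Subtype.ext (AEEqFun.ext h)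

lemma fn_zero : (0 : L2Field g q).fn =ᵐ[q] 0 := AEEqFun.coeFn_zero

variable (g q) in
/-- The inner product `⟨X, Y⟩ = E_q[g(X, Y)]`. -/
@[reducible] noncomputable def core : InnerProductSpace.Core ℝ (L2Field g q) where
  inner X Y := ∫ x, g.ip x (X.fn x) (Y.fn x) ∂q
  conj_inner_symm X Y := by
    simp only [conj_trivial]
    exact integral_congr_ae (.of_forall fun x => g.ip_comm x _ _)
  re_inner_nonneg X := integral_nonneg fun x => g.ip_self_nonneg x _
  add_left X Y Z := by
    rw [← integral_add (X.memL2_fn.integrable_ip Z.memL2_fn)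
      (Y.memL2_fn.integrable_ip Z.memL2_fn)]
    refine integral_congr_ae ?_
    filter_upwards [fn_add X Y] with x hx
    rw [hx, Pi.add_apply, g.ip_add_left]
  smul_left X Y c := by
    simp only [conj_trivial]
    rw [← integral_const_mul]
    refine integral_congr_ae ?_
    filter_upwards [fn_smul c X] with x hx
    rw [hx, Pi.smul_apply, g.ip_smul_left]
  definite X hX := by
    have h := (integral_eq_zero_iff_of_nonneg (fun x => g.ip_self_nonneg x _) X.2).1 hX
    refine ext_fn ?_
    filter_upwards [h, fn_zero (g := g) (q := q)] with x hx h0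
    rw [h0]
    by_contra hne
    exact (g.ip_self_pos x hne).ne' hx

noncomputable instance : NormedAddCommGroup (L2Field g q) :=
  (core g q).toNormedAddCommGroup

noncomputable instance : InnerProductSpace ℝ (L2Field g q) :=
  InnerProductSpace.ofCore (core g q).toCore

lemma inner_def (X Y : L2Field g q) : inner ℝ X Y = ∫ x, g.ip x (X.fn x) (Y.fn x) ∂q := rfl

lemma norm_sq_eq (X : L2Field g q) : ‖X‖ ^ 2 = ∫ x, g.ip x (X.fn x) (X.fn x) ∂q := by
  rw [← real_inner_self_eq_norm_sq, inner_def]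

lemma lintegral_ip_fn (X : L2Field g q) :
    ∫⁻ x, ENNReal.ofReal (g.ip x (X.fn x) (X.fn x)) ∂q = ENNReal.ofReal (‖X‖ ^ 2) := by
  rw [norm_sq_eq, ofReal_integral_eq_lintegral_ofReal X.memL2_fn.2
    (.of_forall fun x => g.ip_self_nonneg x _)]

end L2Field

namespace RiemannianStructure

variable {n : ℕ} (g : RiemannianStructure n)

lemma continuous_inv_coeff (i j : Fin n) : Continuous fun x => (g.coeff x)⁻¹ i j := by
  have hA : Continuous g.coeff :=
    continuous_matrix fun i j => g.continuous_coeff i j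
  have hd : ∀ x, (g.coeff x).det ≠ 0 := fun x => (g.posDef x).det_pos.ne'
  have h : (fun x => (g.coeff x)⁻¹ i j)
      = fun x => ((g.coeff x).det)⁻¹ * (g.coeff x).adjugate i j := by
    funext x
    simp [Matrix.inv_def]
  rw [h]
  exact (hA.matrix_det.inv₀ hd).mul (hA.matrix_adjugate.matrix_elem i j)

lemma ip_mulVec_inv (x u v : Coord n) :
    g.ip x u (WithLp.toLp 2 ((g.coeff x)⁻¹.mulVec v.ofLp)) = dotProduct u.ofLp v.ofLp := by
  rw [ip_eq_dotProduct]
  have hu : IsUnit (g.coeff x).det := (g.posDef x).det_pos.ne'.isUnit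
  simp [Matrix.mulVec_mulVec, Matrix.mul_nonsing_inv _ hu]

lemma ip_sq_le (x u v : Coord n) : g.ip x u v ^ 2 ≤ g.ip x u u * g.ip x v v := by
  have hq : ∀ t : ℝ, 0 ≤ g.ip x u u * (t * t) + 2 * g.ip x u v * t + g.ip x v v := by
    intro t
    have h := g.ip_self_nonneg x (t • u + v)
    have hc := g.ip_comm x u v
    simp only [ip_add_left, ip_add_right, ip_smul_left, ip_smul_right] at h
    rw [← hc] at h
    nlinarith
  have h := discrim_le_zero hq
  unfold discrim at h
  nlinarith

/-- A continuous upper bound for the operator norm of `g⁻¹`. -/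
noncomputable def invBound (x : Coord n) : ℝ := 1 + ∑ i, ∑ j, |(g.coeff x)⁻¹ i j|

lemma continuous_invBound : Continuous g.invBound := by
  unfold invBound
  refine continuous_const.add
    (continuous_finsetSum _ fun i _ => continuous_finsetSum _ fun j _ => ?_)
  exact (g.continuous_inv_coeff i j).abs

lemma invBound_pos (x : Coord n) : 0 < g.invBound x := by
  have : 0 ≤ ∑ i, ∑ j, |(g.coeff x)⁻¹ i j| :=
    Finset.sum_nonneg fun i _ => Finset.sum_nonneg fun j _ => abs_nonneg _
  unfold invBound; linarith

lemma dotProduct_inv_le (x v : Coord n) :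
    dotProduct ((g.coeff x)⁻¹.mulVec v.ofLp) v.ofLp ≤ g.invBound x * ‖v‖ ^ 2 := by
  have h1 : dotProduct ((g.coeff x)⁻¹.mulVec v.ofLp) v.ofLp
      ≤ ∑ i, ∑ j, |(g.coeff x)⁻¹ i j| * ‖v‖ ^ 2 := by
    unfold dotProduct Matrix.mulVec dotProduct
    refine Finset.sum_le_sum fun i _ => ?_
    rw [Finset.sum_mul]
    refine Finset.sum_le_sum fun j _ => ?_
    have hi : |v.ofLp i| ≤ ‖v‖ := by simpa using PiLp.norm_apply_le v i
    have hj : |v.ofLp j| ≤ ‖v‖ := by simpa using PiLp.norm_apply_le v j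
    calc (g.coeff x)⁻¹ i j * v.ofLp j * v.ofLp i
        ≤ |(g.coeff x)⁻¹ i j * v.ofLp j * v.ofLp i| := le_abs_self _
      _ = |(g.coeff x)⁻¹ i j| * (|v.ofLp j| * |v.ofLp i|) := by
          rw [abs_mul, abs_mul, mul_assoc]
      _ ≤ |(g.coeff x)⁻¹ i j| * (‖v‖ * ‖v‖) := by gcongr
      _ = |(g.coeff x)⁻¹ i j| * ‖v‖ ^ 2 := by ring
  refine h1.trans ?_
  simp only [← Finset.sum_mul]
  unfold invBound
  nlinarith [sq_nonneg ‖v‖]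

lemma norm_sq_le (x v : Coord n) : ‖v‖ ^ 2 ≤ g.invBound x * g.ip x v v := by
  set w : Coord n := WithLp.toLp 2 ((g.coeff x)⁻¹.mulVec v.ofLp) with hw
  have h1 : g.ip x v w = ‖v‖ ^ 2 := by
    rw [hw, ip_mulVec_inv, EuclideanSpace.real_norm_sq_eq]
    unfold dotProduct
    exact Finset.sum_congr rfl fun i _ => (sq _).symm
  have h2 : g.ip x w w ≤ g.invBound x * ‖v‖ ^ 2 := by
    have : g.ip x w w = dotProduct w.ofLp v.ofLp := g.ip_mulVec_inv x w v
    rw [this]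
    exact g.dotProduct_inv_le x v
  have h3 := g.ip_sq_le x v w
  rw [h1] at h3
  have h4 := g.ip_self_nonneg x v
  rcases eq_or_lt_of_le (sq_nonneg ‖v‖) with h0 | h0
  · rw [← h0]; exact mul_nonneg (g.invBound_pos x).le h4
  · have h5 : ‖v‖ ^ 2 * ‖v‖ ^ 2 ≤ (g.invBound x * g.ip x v v) * ‖v‖ ^ 2 := by
      nlinarith [mul_le_mul_of_nonneg_left h2 h4]
    exact le_of_mul_le_mul_right h5 h0

end RiemannianStructure

namespace L2Field

variable {n : ℕ} {g : RiemannianStructure n} {q : Measure (Coord n)}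

lemma norm_scaled_sq_le (x v : Coord n) :
    ‖(√(g.invBound x))⁻¹ • v‖ ^ 2 ≤ g.ip x v v := by
  have hb := g.invBound_pos x
  rw [norm_smul, mul_pow, norm_inv, Real.norm_of_nonneg (Real.sqrt_nonneg _), inv_pow,
    Real.sq_sqrt hb.le, inv_mul_le_iff₀ hb]
  exact g.norm_sq_le x v

lemma memLp_scaled (X : L2Field g q) :
    MemLp (fun x => (√(g.invBound x))⁻¹ • X.fn x) 2 q := by
  have hc : Continuous fun x => (√(g.invBound x))⁻¹ :=
    (g.continuous_invBound.sqrt).inv₀ fun x => (Real.sqrt_pos.2 (g.invBound_pos x)).ne'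
  have hm : AEStronglyMeasurable (fun x => (√(g.invBound x))⁻¹ • X.fn x) q :=
    hc.aestronglyMeasurable.smul X.memL2_fn.1
  refine (memLp_two_iff_integrable_sq_norm hm).2 ?_
  refine Integrable.mono' X.2 (hm.norm.pow 2) ?_
  filter_upwards with x
  rw [Real.norm_of_nonneg (sq_nonneg _)]
  exact norm_scaled_sq_le x _

lemma dist_scaled_le (X Y : L2Field g q) :
    dist (X.memLp_scaled.toLp _) (Y.memLp_scaled.toLp _) ≤ dist X Y := by
  rw [dist_eq_norm, dist_eq_norm, ← MemLp.toLp_sub]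
  refine le_of_sq_le_sq ?_ (norm_nonneg _)
  rw [norm_sq_eq, ← real_inner_self_eq_norm_sq, L2.inner_def]
  refine integral_mono_ae (L2.integrable_inner _ _) (X - Y).2 ?_
  filter_upwards [MemLp.coeFn_toLp (X.memLp_scaled.sub Y.memLp_scaled), fn_sub X Y] with x hx hs
  rw [hx, real_inner_self_eq_norm_sq, hs]
  simp only [Pi.sub_apply, ← smul_sub]
  exact norm_scaled_sq_le x _

instance : CompleteSpace (L2Field g q) := by
  refine Metric.complete_of_cauchySeq_tendsto fun X hX => ?_
  have hY : CauchySeq fun k => (X k).memLp_scaled.toLp _ := by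
    rw [Metric.cauchySeq_iff] at hX ⊢
    intro ε hε
    obtain ⟨N, hN⟩ := hX ε hε
    exact ⟨N, fun m hm k hk => (dist_scaled_le _ _).trans_lt (hN m hm k hk)⟩
  obtain ⟨Y, hY⟩ := cauchySeq_tendsto_of_complete hY
  obtain ⟨ns, hns, hlim⟩ := (tendstoInMeasure_of_tendsto_Lp hY).exists_seq_tendsto_ae
  set Z : Coord n → Coord n := fun x => √(g.invBound x) • Y x with hZ
  have hZm : AEStronglyMeasurable Z q :=
    g.continuous_invBound.sqrt.aestronglyMeasurable.smul (Lp.aestronglyMeasurable Y)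
  have hae : ∀ᵐ x ∂q, Filter.Tendsto (fun k => (X (ns k)).fn x) Filter.atTop (nhds (Z x)) := by
    have hall : ∀ᵐ x ∂q, ∀ k, ((X (ns k)).memLp_scaled.toLp _) x
        = (√(g.invBound x))⁻¹ • (X (ns k)).fn x :=
      ae_all_iff.2 fun k => MemLp.coeFn_toLp _
    filter_upwards [hlim, hall] with x hx hk
    have h := hx.const_smul (√(g.invBound x))
    refine h.congr fun k => ?_
    rw [hk, smul_inv_smul₀ (Real.sqrt_pos.2 (g.invBound_pos x)).ne']
  have hfatou : ∀ ε : ℝ, 0 < ε → ∃ N, ∀ m, N ≤ m →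
      ∫⁻ x, ENNReal.ofReal (g.ip x ((X m).fn x - Z x) ((X m).fn x - Z x)) ∂q
        ≤ ENNReal.ofReal (ε ^ 2) := by
    intro ε hε
    rw [Metric.cauchySeq_iff] at hX
    obtain ⟨N, hN⟩ := hX ε hε
    refine ⟨N, fun m hm => ?_⟩
    have hmeas : ∀ k, AEMeasurable (fun x => ENNReal.ofReal
        (g.ip x ((X m - X (ns k)).fn x) ((X m - X (ns k)).fn x))) q := fun k =>
      (g.aestronglyMeasurable_ip (X m - X (ns k)).memL2_fn.1
        (X m - X (ns k)).memL2_fn.1).aemeasurable.ennreal_ofReal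
    have hsub : ∀ᵐ x ∂q, ∀ k, (X m - X (ns k)).fn x = (X m).fn x - (X (ns k)).fn x :=
      ae_all_iff.2 fun k => fn_sub _ _
    calc ∫⁻ x, ENNReal.ofReal (g.ip x ((X m).fn x - Z x) ((X m).fn x - Z x)) ∂q
        = ∫⁻ x, Filter.liminf (fun k => ENNReal.ofReal
            (g.ip x ((X m - X (ns k)).fn x) ((X m - X (ns k)).fn x))) Filter.atTop ∂q := by
          refine lintegral_congr_ae ?_
          filter_upwards [hae, hsub] with x hx hs
          simp only [hs]
          have hc : Continuous fun v : Coord n => ENNReal.ofReal (g.ip x v v) := by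
            refine ENNReal.continuous_ofReal.comp ?_
            exact g.continuous_ip.comp
              (continuous_const.prodMk (continuous_id.prodMk continuous_id))
          exact (((hc.tendsto _).comp (hx.const_sub ((X m).fn x))).liminf_eq).symm
      _ ≤ Filter.liminf (fun k => ∫⁻ x, ENNReal.ofReal
            (g.ip x ((X m - X (ns k)).fn x) ((X m - X (ns k)).fn x)) ∂q) Filter.atTop :=
          lintegral_liminf_le' hmeas
      _ ≤ ENNReal.ofReal (ε ^ 2) := by
          simp only [lintegral_ip_fn]
          refine Filter.liminf_le_of_frequently_le' (Filter.Eventually.frequently ?_)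
          filter_upwards [Filter.eventually_ge_atTop N] with k hk
          refine ENNReal.ofReal_le_ofReal ?_
          have h := hN m hm (ns k) (hk.trans (hns.id_le k))
          rw [dist_eq_norm] at h
          exact pow_le_pow_left₀ (norm_nonneg _) h.le 2
  have hdiff : ∀ m, (∫⁻ x, ENNReal.ofReal (g.ip x ((X m).fn x - Z x) ((X m).fn x - Z x)) ∂q ≠ (⊤ : ℝ≥0∞)) →
      g.MemL2 q fun x => (X m).fn x - Z x := by
    intro m hm
    have hs : AEStronglyMeasurable (fun x => (X m).fn x - Z x) q := (X m).memL2_fn.1.sub hZm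
    exact ⟨hs, (lintegral_ofReal_ne_top_iff_integrable (g.aestronglyMeasurable_ip hs hs)
      (.of_forall fun x => g.ip_self_nonneg x _)).1 hm⟩
  obtain ⟨N, hN⟩ := hfatou 1 one_pos
  set W : L2Field g q := X N - mk _ (hdiff N (ne_top_of_le_ne_top ENNReal.ofReal_ne_top
    (hN N le_rfl))) with hW
  have hWZ : W.fn =ᵐ[q] Z := by
    filter_upwards [fn_sub (X N) (mk _ (hdiff N (ne_top_of_le_ne_top ENNReal.ofReal_ne_top
      (hN N le_rfl)))), fn_mk _ (hdiff N (ne_top_of_le_ne_top ENNReal.ofReal_ne_top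
      (hN N le_rfl)))] with x h1 h2
    rw [hW, h1, Pi.sub_apply, h2, sub_sub_cancel]
  refine ⟨W, Metric.tendsto_atTop.2 fun ε hε => ?_⟩
  obtain ⟨M, hM⟩ := hfatou (ε / 2) (half_pos hε)
  refine ⟨M, fun m hm => ?_⟩
  have h1 : ∫⁻ x, ENNReal.ofReal (g.ip x ((X m - W).fn x) ((X m - W).fn x)) ∂q
      ≤ ENNReal.ofReal ((ε / 2) ^ 2) := by
    refine le_trans (le_of_eq (lintegral_congr_ae ?_)) (hM m hm)
    filter_upwards [hWZ, fn_sub (X m) W] with x h2 h3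
    rw [h3, Pi.sub_apply, h2]
  rw [lintegral_ip_fn, ENNReal.ofReal_le_ofReal_iff (by positivity)] at h1
  rw [dist_eq_norm]
  have := le_of_sq_le_sq h1 (half_pos hε).le
  linarith

end L2Field

section Wasserstein

variable {n : ℕ} (g : RiemannianStructure n)

/-- The tangent space `T_q P(M)`: the closure in `L²_q(M)` of the gradients of compactly supported
smooth functions. -/
noncomputable def tangentSpace (q : Measure (Coord n)) : Submodule ℝ (L2Field g q) :=
  (Submodule.span ℝ {Y : L2Field g q | ∃ f : Coord n → ℝ,
    ContDiff ℝ ∞ f ∧ HasCompactSupport f ∧ Y.fn =ᵐ[q] g.grad f}).topologicalClosure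

instance (q : Measure (Coord n)) : CompleteSpace (tangentSpace g q) := by
  unfold tangentSpace; infer_instance

/-- The orthogonal projection `π_q : L²_q(M) → T_q P(M)`. -/
noncomputable def tangentProj (q : Measure (Coord n)) : L2Field g q →L[ℝ] L2Field g q :=
  (tangentSpace g q).starProjection

end Wasserstein

/-- A smooth family of maps `φ_t` of the manifold with `φ_0 = id` and `φ_t = id` outside a compact
set; `φ_t` is a diffeomorphism for small `|t|`. Flows of compactly supported smooth vector fields
are of this kind. -/
structure Variation (n : ℕ) where
  /-- the map `(t, x) ↦ φ_t(x)` -/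
  toFun : ℝ → Coord n → Coord n
  smooth : ContDiff ℝ ∞ fun z : ℝ × Coord n => toFun z.1 z.2
  zero : ∀ x, toFun 0 x = x
  eq_outside : ∃ K : Set (Coord n), IsCompact K ∧ ∀ t, ∀ x ∉ K, toFun t x = x

namespace Variation

variable {n : ℕ} (φ : Variation n)

/-- The initial velocity field `x ↦ d/dt φ_t(x)` at `t = 0`. -/
noncomputable def velocity (x : Coord n) : Coord n := deriv (fun t => φ.toFun t x) 0

lemma continuous_toFun (t : ℝ) : Continuous (φ.toFun t) :=
  φ.smooth.continuous.comp (continuous_const.prodMk continuous_id)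

lemma continuous_velocity : Continuous φ.velocity := by
  have h : φ.velocity = fun x =>
      fderiv ℝ (fun z : ℝ × Coord n => φ.toFun z.1 z.2) (0, x) (1, 0) := by
    funext x
    have h1 : HasFDerivAt (fun z : ℝ × Coord n => φ.toFun z.1 z.2)
        (fderiv ℝ (fun z : ℝ × Coord n => φ.toFun z.1 z.2) (0, x)) ((0 : ℝ), x) :=
      (φ.smooth.differentiable (by simp) _).hasFDerivAt
    have h2 : HasDerivAt (fun t : ℝ => (t, x)) ((1 : ℝ), (0 : Coord n)) 0 :=
      (hasDerivAt_id (0 : ℝ)).prodMk (hasDerivAt_const (0 : ℝ) x)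
    exact (h1.comp_hasDerivAt (0 : ℝ) h2).deriv
  rw [h]
  have h3 := φ.smooth.continuous_fderiv (by simp)
  exact (h3.comp (continuous_const.prodMk continuous_id)).clm_apply continuous_const

lemma hasCompactSupport_velocity : HasCompactSupport φ.velocity := by
  obtain ⟨K, hK, h⟩ := φ.eq_outside
  refine HasCompactSupport.intro hK fun x hx => ?_
  have : (fun t => φ.toFun t x) = fun _ => x := funext fun t => h t x hx
  simp [velocity, this]

/-- The curve `t ↦ (φ_t)_# q` in `P(M)` through `q`. -/
noncomputable def curve (q : ProbabilityMeasure (Coord n)) (t : ℝ) :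
    ProbabilityMeasure (Coord n) :=
  q.map (φ.continuous_toFun t).measurable.aemeasurable

/-- The tangent vector at `t = 0` of the curve `t ↦ (φ_t)_# q`: the projection to `T_q P(M)` of the
velocity field of `φ`. -/
noncomputable def tangentVector (g : RiemannianStructure n) (q : ProbabilityMeasure (Coord n)) :
    L2Field g (q : Measure (Coord n)) :=
  tangentProj g q (L2Field.mk φ.velocity
    (g.memL2_of_hasCompactSupport q φ.continuous_velocity φ.hasCompactSupport_velocity))

end Variation

section Functionals

variable {n : ℕ}

/-- `v = grad F(q)`: the vector `v ∈ T_q P(M)` such that the derivative of `F` along curves through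
`q` is the inner product of `v` with their tangent vectors. -/
def HasGradientAt (g : RiemannianStructure n) (F : ProbabilityMeasure (Coord n) → ℝ)
    (q : ProbabilityMeasure (Coord n)) (v : L2Field g (q : Measure (Coord n))) : Prop :=
  v ∈ tangentSpace g q ∧
    ∀ φ : Variation n, HasDerivAt (fun t => F (φ.curve q t)) (inner ℝ v (φ.tangentVector g q)) 0

/-- The linear function `F_f : q ↦ E_q[f]` on `P(M)`. -/
noncomputable def linearFunctional (f : Coord n → ℝ) (q : ProbabilityMeasure (Coord n)) : ℝ :=
  ∫ x, f x ∂(q : Measure (Coord n))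

/-- `F_f` is a linearization of `F` at `q`: `f` is a smooth `q`-integrable function and
`grad F_f(q) = grad F(q)`. -/
def IsLinearizationAt (g : RiemannianStructure n) (F : ProbabilityMeasure (Coord n) → ℝ)
    (q : ProbabilityMeasure (Coord n)) (f : Coord n → ℝ) : Prop :=
  ContDiff ℝ ∞ f ∧ Integrable f (q : Measure (Coord n)) ∧
    ∃ v : L2Field g (q : Measure (Coord n)),
      HasGradientAt g F q v ∧ HasGradientAt g (linearFunctional f) q v

/-- The Poisson bracket on `P(M)`: `{F, H}(q) = c`, where `c = F_{f, h}(q) = E_q[{f, h}]` for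
linearizations `F_f`, `F_h` of `F`, `H` at `q`. -/
def HasPoissonBracketAt (g : RiemannianStructure n) (β : PoissonStructure n)
    (F H : ProbabilityMeasure (Coord n) → ℝ) (q : ProbabilityMeasure (Coord n)) (c : ℝ) : Prop :=
  ∃ f h : Coord n → ℝ, IsLinearizationAt g F q f ∧ IsLinearizationAt g H q h ∧
    Integrable (β.bracket f h) (q : Measure (Coord n)) ∧ c = linearFunctional (β.bracket f h) q

/-- `V` is the value at `q` of the Hamiltonian vector field `{·, F}` of `F` on `P(M)`: `F` has a
linearization at `q`, `V ∈ T_q P(M)`, and the derivative of any function `G` in direction `V` is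
`{G, F}(q)`, for all `G` that have a gradient at `q` and a Poisson bracket with `F` at `q`. -/
def IsHamiltonianVectorAt (g : RiemannianStructure n) (β : PoissonStructure n)
    (F : ProbabilityMeasure (Coord n) → ℝ) (q : ProbabilityMeasure (Coord n))
    (V : L2Field g (q : Measure (Coord n))) : Prop :=
  (∃ f, IsLinearizationAt g F q f) ∧ V ∈ tangentSpace g q ∧
    ∀ (G : ProbabilityMeasure (Coord n) → ℝ) (w : L2Field g (q : Measure (Coord n))) (c : ℝ),
      HasGradientAt g G q w → HasPoissonBracketAt g β G F q c → inner ℝ w V = c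

/-- The function `KL_p` on `P(M)` (real-valued where the divergence is finite). -/
noncomputable def KL (p q : ProbabilityMeasure (Coord n)) : ℝ :=
  (InformationTheory.klDiv (q : Measure (Coord n)) (p : Measure (Coord n))).toReal

/-- `ρ` is a smooth positive density of `q` with respect to Lebesgue measure in coordinates. -/
def IsSmoothPosDensity (q : ProbabilityMeasure (Coord n)) (ρ : Coord n → ℝ) : Prop :=
  ContDiff ℝ ∞ ρ ∧ (∀ x, 0 < ρ x) ∧
    (q : Measure (Coord n)) = volume.withDensity fun x => ENNReal.ofReal (ρ x)

end Functionals

end WassersteinPoisson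

open WassersteinPoisson

/-! The divergence is differentiated by moving the reference measure instead of q. For small t the
map φ_t is an orientation-preserving diffeomorphism, and KL(φ_t# q ‖ p) = KL(q ‖ φ_t^* p) =
E_q[log(q / ((p ∘ φ_t) det Dφ_t))] (`KL_curve`). This integrand depends on t only over a compact
set, so it can be differentiated under the integral. The change of variables formula, differentiated
at t = 0, turns the Jacobian term into E_q[d log q(X)], and the derivative becomes E_q[d
log(q/p)(X)] (`hasDerivAt_KL_curve`). This is also the derivative of F_u for u = log(q/p), so F_u
linearizes the divergence at q once grad u is tangent.

On a complete manifold tangency is automatic (`IsComplete.mk_grad_mem_tangentSpace`): grad u is the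
L² limit of the gradients of ψ_k T_k, where ψ_k is a cutoff with small gradient, obtained by
mollifying a function of the geodesic distance, and T_k is a bounded truncation of u.

The rest is duality (`isHamiltonianVectorAt_iff`). If f linearizes G, then {G, F}(q) = E_q[{f, u}] =
⟨grad f, X_u⟩ = ⟨grad G, π_q X_u⟩. The choice of linearizations is immaterial, because a gradient of
F_f, when it exists, is grad f almost everywhere (`HasGradientAt.fn_ae_eq_grad`) and the bracket
sees only differentials. Uniqueness follows by taking G = F_f with f a test function, since these
gradients span a dense subspace of the tangent space. -/

namespace WassersteinPoisson

/-! ### Tools from calculus and measure theory. -/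

open Filter Topology Set in
/-- A continuous function of `(t, x)` that is constant at `t = 0` and off a compact set is
uniformly close to that constant for small `t`. -/
lemma eventually_forall_dist_lt_of_eq_off_compact {E F : Type*} [TopologicalSpace E]
    [PseudoMetricSpace F] {f : ℝ × E → F} (hf : Continuous f) {c : F} (h0 : ∀ x, f (0, x) = c)
    {K : Set E} (hK : IsCompact K) (hoff : ∀ t, ∀ x ∉ K, f (t, x) = c) {ε : ℝ} (hε : 0 < ε) :
    ∀ᶠ t in 𝓝 (0 : ℝ), ∀ x, dist (f (t, x)) c < ε := by
  have h1 : ∀ᶠ t in 𝓝 (0 : ℝ), ∀ x ∈ K, dist (f (t, x)) c < ε := by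
    -- Tube lemma: smallness near each point (0, x) with x in K gives one time neighbourhood valid
    -- for all of K.
    refine hK.eventually_forall_of_forall_eventually fun x _ => ?_
    have : Tendsto (fun z : ℝ × E => dist (f z) c) (𝓝 (0, x)) (𝓝 0) := by
      have h := (hf.dist (continuous_const (y := c))).tendsto ((0 : ℝ), x)
      simpa [h0] using h
    exact this.eventually_lt_const hε
  filter_upwards [h1] with t ht x
  by_cases hx : x ∈ K
  · exact ht x hx
  · rw [hoff t x hx, dist_self]; exact hε

open Filter Topology Set in
/-- Differentiation under the integral for a `C¹` family that is constant in time off a compact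
set. -/
lemma hasDerivAt_integral_of_eq_off_compact {E : Type*} [NormedAddCommGroup E] [NormedSpace ℝ E]
    [MeasurableSpace E] [BorelSpace E] [SecondCountableTopology E]
    {μ : Measure E} [IsFiniteMeasureOnCompacts μ] {H : ℝ → E → ℝ} {δ : ℝ} (hδ : 0 < δ)
    (hH : ContDiffOn ℝ 1 (fun z : ℝ × E => H z.1 z.2) (Metric.ball 0 δ ×ˢ univ))
    {K : Set E} (hK : IsCompact K) (hoff : ∀ t ∈ Metric.ball (0 : ℝ) δ, ∀ x ∉ K, H t x = H 0 x)
    (hint : Integrable (H 0) μ) :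
    Integrable (fun x => deriv (fun t => H t x) 0) μ ∧
    HasDerivAt (fun t => ∫ x, H t x ∂μ) (∫ x, deriv (fun t => H t x) 0 ∂μ) 0 := by
  set G : ℝ × E → ℝ := fun z => H z.1 z.2 with hG
  have hopen : IsOpen (Metric.ball (0 : ℝ) δ ×ˢ (univ : Set E)) := Metric.isOpen_ball.prod isOpen_univ
  have hderiv : ∀ t ∈ Metric.ball (0 : ℝ) δ, ∀ x,
      HasDerivAt (fun t => H t x) (fderiv ℝ G (t, x) (1, 0)) t := by
    intro t ht x
    have h1 : HasFDerivAt G (fderiv ℝ G (t, x)) (t, x) :=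
      ((hH.contDiffAt (hopen.mem_nhds ⟨ht, mem_univ x⟩)).differentiableAt one_ne_zero).hasFDerivAt
    have h2 : HasDerivAt (fun t : ℝ => (t, x)) ((1 : ℝ), (0 : E)) t :=
      (hasDerivAt_id t).prodMk (hasDerivAt_const t x)
    exact h1.comp_hasDerivAt t h2
  have hcont : ContinuousOn (fun z => fderiv ℝ G z (1, 0)) (Metric.ball (0 : ℝ) δ ×ˢ (univ : Set E)) :=
    (hH.continuousOn_fderiv_of_isOpen hopen le_rfl).clm_apply continuousOn_const
  have hslice : ∀ t ∈ Metric.ball (0 : ℝ) δ, Continuous (H t) := fun t ht => by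
    rw [← continuousOn_univ]
    exact hH.continuousOn.comp (f := fun x : E => (t, x)) (by fun_prop) fun x _ => ⟨ht, mem_univ _⟩
  have hsub : Metric.closedBall (0 : ℝ) (δ / 2) ⊆ Metric.ball 0 δ :=
    Metric.closedBall_subset_ball (by linarith)
  -- Halving δ makes the time interval compact, so the time derivative is bounded over K. It
  -- vanishes off K, and C · 1_K is an integrable majorant because K has finite measure.
  obtain ⟨C, hC⟩ := ((isCompact_closedBall (0 : ℝ) (δ / 2)).prod hK).exists_bound_of_continuousOn
    (hcont.mono (prod_mono hsub (subset_univ K)))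
  have h0 : (0 : ℝ) ∈ Metric.ball (0 : ℝ) δ := Metric.mem_ball_self hδ
  have hzero : ∀ t ∈ Metric.ball (0 : ℝ) δ, ∀ x ∉ K, fderiv ℝ G (t, x) (1, 0) = 0 := by
    intro t ht x hx
    refine (hderiv t ht x).unique ((hasDerivAt_const t (H 0 x)).congr_of_eventuallyEq ?_)
    filter_upwards [Metric.isOpen_ball.mem_nhds ht] with s hs using hoff s hs x hx
  have hd : (fun x => deriv (fun t => H t x) 0) = fun x => fderiv ℝ G (0, x) (1, 0) :=
    funext fun x => (hderiv 0 h0 x).deriv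
  rw [hd]
  refine hasDerivAt_integral_of_dominated_loc_of_deriv_le
    (F' := fun t x => fderiv ℝ G (t, x) (1, 0)) (bound := K.indicator fun _ => C)
    (Metric.closedBall_mem_nhds 0 (half_pos hδ)) ?_ hint ?_ ?_ ?_ ?_
  · filter_upwards [Metric.ball_mem_nhds 0 hδ] with t ht using (hslice t ht).aestronglyMeasurable
  · refine Continuous.aestronglyMeasurable ?_
    rw [← continuousOn_univ]
    exact hcont.comp (f := fun x : E => ((0 : ℝ), x)) (by fun_prop) fun x _ => ⟨h0, mem_univ _⟩
  · refine .of_forall fun x t ht => ?_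
    by_cases hx : x ∈ K
    · rw [indicator_of_mem hx]
      exact hC (t, x) ⟨ht, hx⟩
    · rw [hzero t (hsub ht) x hx, norm_zero, indicator_of_notMem hx]
  · exact IntegrableOn.integrable_indicator (integrableOn_const hK.measure_lt_top.ne)
      hK.measurableSet
  · exact .of_forall fun x t ht => hderiv t (hsub ht) x

/-- The determinant is a smooth function of a continuous endomorphism. -/
lemma contDiff_clm_det {E : Type*} [NormedAddCommGroup E] [NormedSpace ℝ E]
    [FiniteDimensional ℝ E] {k : WithTop ℕ∞} :
    ContDiff ℝ k fun A : E →L[ℝ] E => A.det := by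
  classical
  -- In a fixed basis the determinant is a polynomial in the matrix entries, and each entry is a
  -- bounded linear function of A.
  have h : (fun A : E →L[ℝ] E => A.det) = fun A : E →L[ℝ] E =>
      ∑ σ : Equiv.Perm (Fin (Module.finrank ℝ E)), (Equiv.Perm.sign σ : ℝ) *
        ∏ i, LinearMap.toMatrix (Module.finBasis ℝ E) (Module.finBasis ℝ E) (A : E →ₗ[ℝ] E)
          (σ i) i := by
    funext A
    rw [ContinuousLinearMap.det, ← LinearMap.det_toMatrix (Module.finBasis ℝ E), Matrix.det_apply']
  rw [h]
  refine ContDiff.sum fun σ _ => contDiff_const.mul (contDiff_prod fun i _ => ?_)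
  simp only [LinearMap.toMatrix_apply]
  have : IsBoundedLinearMap ℝ fun A : E →L[ℝ] E =>
      (Module.finBasis ℝ E).repr ((A : E →ₗ[ℝ] E) (Module.finBasis ℝ E i)) (σ i) := by
    have := ((LinearMap.toContinuousLinearMap ((Module.finBasis ℝ E).coord (σ i))).comp
      (ContinuousLinearMap.apply ℝ E (Module.finBasis ℝ E i))).isBoundedLinearMap
    exact this
  exact this.contDiff

open InformationTheory in
/-- The Kullback-Leibler divergence is invariant under measurable isomorphisms. -/
lemma klDiv_map_measurableEquiv {α β : Type*} [MeasurableSpace α] [MeasurableSpace β]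
    (μ ν : Measure α) [IsFiniteMeasure μ] [IsFiniteMeasure ν] (e : α ≃ᵐ β) :
    klDiv (μ.map e) (ν.map e) = klDiv μ ν := by
  -- Data processing inequality, applied to e and then to its inverse.
  refine le_antisymm (klDiv_map_le _ _ e.measurable) ?_
  have h := klDiv_map_le (μ.map e) (ν.map e) e.symm.measurable
  simpa [Measure.map_map e.symm.measurable e.measurable] using h

/-- The log-likelihood ratio of two measures with positive densities. -/
lemma llr_withDensity_ofReal {α : Type*} [MeasurableSpace α] {μ : Measure α} [SigmaFinite μ]
    {a b : α → ℝ} (ha : Measurable a) (hb : Measurable b) (ha0 : ∀ x, 0 < a x) (hb0 : ∀ x, 0 < b x) :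
    μ.withDensity (fun x => ENNReal.ofReal (a x)) ≪ μ.withDensity (fun x => ENNReal.ofReal (b x)) ∧
    llr (μ.withDensity fun x => ENNReal.ofReal (a x)) (μ.withDensity fun x => ENNReal.ofReal (b x))
      =ᵐ[μ.withDensity fun x => ENNReal.ofReal (a x)] fun x => Real.log (a x / b x) := by
  have hdiv : Measurable fun x => ENNReal.ofReal (a x / b x) := (ha.div hb).ennreal_ofReal
  -- Since b > 0, the measure a μ equals (a / b)(b μ), which exhibits a / b as the Radon-Nikodym
  -- derivative.
  have hab : μ.withDensity (fun x => ENNReal.ofReal (a x))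
      = (μ.withDensity (fun x => ENNReal.ofReal (b x))).withDensity
        fun x => ENNReal.ofReal (a x / b x) := by
    rw [← withDensity_mul (f := fun x => ENNReal.ofReal (b x))
      (g := fun x => ENNReal.ofReal (a x / b x)) _ hb.ennreal_ofReal hdiv]
    congr 1
    funext x
    rw [Pi.mul_apply, ← ENNReal.ofReal_mul (hb0 x).le, mul_div_cancel₀ _ (hb0 x).ne']
  have hac : μ.withDensity (fun x => ENNReal.ofReal (a x))
      ≪ μ.withDensity (fun x => ENNReal.ofReal (b x)) := by
    rw [hab]; exact withDensity_absolutelyContinuous _ _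
  refine ⟨hac, ?_⟩
  have : SigmaFinite (μ.withDensity fun x => ENNReal.ofReal (b x)) :=
    SigmaFinite.withDensity_of_ne_top (.of_forall fun _ => ENNReal.ofReal_ne_top)
  have h := Measure.rnDeriv_withDensity (μ.withDensity fun x => ENNReal.ofReal (b x))
    hdiv
  filter_upwards [hac.ae_le h] with x hx
  rw [llr, hab]
  rw [hx, ENNReal.toReal_ofReal (div_pos (ha0 x) (hb0 x)).le]

end WassersteinPoisson

/-! ### Variations: invertibility for small time, Jacobians and change of variables. -/

namespace WassersteinPoisson

namespace Variation

open Filter Topology Set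

variable {n : ℕ} (φ : Variation n)

/-- The Jacobian determinant of `φ_t`. -/
noncomputable def jac (t : ℝ) (x : Coord n) : ℝ := (fderiv ℝ (φ.toFun t) x).det

lemma contDiff_fderiv : ContDiff ℝ ∞ fun z : ℝ × Coord n => fderiv ℝ (φ.toFun z.1) z.2 := by
  have h : ContDiff ℝ ∞ (Function.uncurry fun z : ℝ × Coord n => φ.toFun z.1) :=
    φ.smooth.comp (contDiff_fst.fst.prodMk contDiff_snd)
  exact h.fderiv contDiff_snd (m := ∞) (by simp)

lemma contDiff_jac : ContDiff ℝ ∞ fun z : ℝ × Coord n => φ.jac z.1 z.2 :=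
  contDiff_clm_det.comp φ.contDiff_fderiv

lemma contDiff_slice (t : ℝ) : ContDiff ℝ ∞ (φ.toFun t) :=
  φ.smooth.comp (contDiff_const.prodMk contDiff_id)

lemma hasFDerivAt_slice (t : ℝ) (x : Coord n) :
    HasFDerivAt (φ.toFun t) (fderiv ℝ (φ.toFun t) x) x :=
  ((φ.contDiff_slice t).differentiable (by simp) x).hasFDerivAt

lemma fderiv_zero (x : Coord n) : fderiv ℝ (φ.toFun 0) x = ContinuousLinearMap.id ℝ _ := by
  have : φ.toFun 0 = id := funext φ.zero
  rw [this, fderiv_id]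

lemma jac_zero (x : Coord n) : φ.jac 0 x = 1 := by
  rw [jac, fderiv_zero]; simp [ContinuousLinearMap.det]

/-- A compact set off which `φ_t = id`. -/
noncomputable def support : Set (Coord n) := φ.eq_outside.choose

lemma isCompact_support : IsCompact φ.support := φ.eq_outside.choose_spec.1

lemma toFun_of_notMem (t : ℝ) {x : Coord n} (hx : x ∉ φ.support) : φ.toFun t x = x :=
  φ.eq_outside.choose_spec.2 t x hx

lemma fderiv_of_notMem (t : ℝ) {x : Coord n} (hx : x ∉ φ.support) :
    fderiv ℝ (φ.toFun t) x = ContinuousLinearMap.id ℝ _ := by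
  have h : φ.toFun t =ᶠ[𝓝 x] id := by
    filter_upwards [φ.isCompact_support.isClosed.isOpen_compl.mem_nhds hx] with y hy
      using φ.toFun_of_notMem t hy
  rw [h.fderiv_eq, fderiv_id]

lemma jac_of_notMem (t : ℝ) {x : Coord n} (hx : x ∉ φ.support) : φ.jac t x = 1 := by
  rw [jac, fderiv_of_notMem _ _ hx]; simp [ContinuousLinearMap.det]

/-- For small `t` the maps `φ_t` are diffeomorphisms preserving the orientation. -/
lemma exists_homeomorph : ∃ δ > 0, ∀ t ∈ Metric.ball (0 : ℝ) δ,
    (∀ x, 0 < φ.jac t x) ∧ ∃ e : Coord n ≃ₜ Coord n, ⇑e = φ.toFun t := by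
  -- Off the support Dφ_t = id and the Jacobian is 1, so both estimates are uniform in x. Distance
  -- 1/2 from the identity will give invertibility, distance 1 from the Jacobian 1 gives positivity.
  have h1 := eventually_forall_dist_lt_of_eq_off_compact φ.contDiff_fderiv.continuous φ.fderiv_zero
    φ.isCompact_support (fun t x hx => φ.fderiv_of_notMem t hx) (ε := 1 / 2) (by norm_num)
  have h2 := eventually_forall_dist_lt_of_eq_off_compact φ.contDiff_jac.continuous φ.jac_zero
    φ.isCompact_support (fun t x hx => φ.jac_of_notMem t hx) one_pos
  obtain ⟨δ, hδ, h⟩ := Metric.eventually_nhds_iff_ball.1 (h1.and h2)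
  refine ⟨δ, hδ, fun t ht => ⟨fun x => ?_, ?_⟩⟩
  · have := (h t ht).2 x
    rw [Real.dist_eq, abs_lt] at this
    dsimp only at this
    linarith
  -- By the mean value inequality on the convex set `univ`, φ_t - id is 1/2-Lipschitz; such a global
  -- perturbation of the identity is a homeomorphism.
  · have happ : ApproximatesLinearOn (φ.toFun t)
        ((ContinuousLinearEquiv.refl ℝ (Coord n) : Coord n ≃L[ℝ] Coord n) :
          Coord n →L[ℝ] Coord n) univ (1 / 2 : ℝ≥0) := by
      intro x _ y _
      refine convex_univ.norm_image_sub_le_of_norm_hasFDerivWithin_le' (𝕜 := ℝ)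
        (fun z _ => (φ.hasFDerivAt_slice t z).hasFDerivWithinAt) (fun z _ => ?_)
        (mem_univ y) (mem_univ x)
      have := (h t ht).1 z
      rw [dist_eq_norm] at this
      simpa using this.le
    -- The Lipschitz constant must lie below the inverse norm of the identity, which is 1 except for
    -- n = 0, where the norm is 0.
    have hc : Subsingleton (Coord n) ∨ (1 / 2 : ℝ≥0) <
        ‖((ContinuousLinearEquiv.refl ℝ (Coord n)).symm : Coord n →L[ℝ] Coord n)‖₊⁻¹ := by
      rcases subsingleton_or_nontrivial (Coord n) with hs | hs
      · exact Or.inl hs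
      · right
        have : ‖((ContinuousLinearEquiv.refl ℝ (Coord n)).symm : Coord n →L[ℝ] Coord n)‖₊ = 1 := by
          have := ContinuousLinearMap.norm_id (𝕜 := ℝ) (E := Coord n)
          exact NNReal.eq this
        rw [this, inv_one, ← NNReal.coe_lt_coe]
        norm_num
    exact ⟨happ.toHomeomorph _ hc, rfl⟩

lemma hasDerivAt_toFun (x : Coord n) : HasDerivAt (fun t => φ.toFun t x) (φ.velocity x) 0 := by
  have : ContDiff ℝ ∞ fun t => φ.toFun t x := φ.smooth.comp (contDiff_id.prodMk contDiff_const)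
  exact (this.differentiable (by simp) 0).hasDerivAt

lemma hasDerivAt_comp {f : Coord n → ℝ} (hf : ContDiff ℝ ∞ f) (x : Coord n) :
    HasDerivAt (fun t => f (φ.toFun t x)) (fderiv ℝ f x (φ.velocity x)) 0 := by
  have h := (hf.differentiable (by simp) (φ.toFun 0 x)).hasFDerivAt
  have := h.comp_hasDerivAt (0 : ℝ) (φ.hasDerivAt_toFun x)
  rwa [φ.zero] at this

lemma hasDerivAt_jac (x : Coord n) :
    HasDerivAt (fun t => φ.jac t x) (deriv (fun t => φ.jac t x) 0) 0 := by
  have : ContDiff ℝ ∞ fun t => φ.jac t x := φ.contDiff_jac.comp (contDiff_id.prodMk contDiff_const)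
  exact (this.differentiable (by simp) 0).hasDerivAt

/-- Linear functionals of smooth functions are differentiable along variations. -/
lemma hasDerivAt_integral_comp {q : Measure (Coord n)} [IsFiniteMeasureOnCompacts q]
    {f : Coord n → ℝ} (hf : ContDiff ℝ ∞ f) (hint : Integrable f q) :
    HasDerivAt (fun t => ∫ x, f (φ.toFun t x) ∂q) (∫ x, fderiv ℝ f x (φ.velocity x) ∂q) 0 := by
  have h := (hasDerivAt_integral_of_eq_off_compact (μ := q) (H := fun t x => f (φ.toFun t x))
    one_pos ((hf.comp φ.smooth).of_le (by simp)).contDiffOn φ.isCompact_support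
    (fun t _ x hx => by simp only [φ.toFun_of_notMem _ hx]) (by simpa only [φ.zero] using hint)).2
  simpa only [(φ.hasDerivAt_comp hf _).deriv] using h

/-- The first variation of the change of variables formula. -/
lemma integral_fderiv_velocity_add {θ : Coord n → ℝ} (hθ : ContDiff ℝ ∞ θ)
    (hint : Integrable θ volume) :
    Integrable (fun x => fderiv ℝ θ x (φ.velocity x) + θ x * deriv (fun t => φ.jac t x) 0) volume ∧
    ∫ x, (fderiv ℝ θ x (φ.velocity x) + θ x * deriv (fun t => φ.jac t x) 0) = 0 := by
  -- For small t the integral of θ(φ_t) det Dφ_t equals that of θ, so its derivative at 0 vanishes.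
  -- This serves as the divergence theorem ∫ div(θX) = 0, with the time derivative of the Jacobian
  -- standing for div X.
  obtain ⟨δ, hδ, h⟩ := φ.exists_homeomorph
  have hd : ∀ x, HasDerivAt (fun t => θ (φ.toFun t x) * φ.jac t x)
      (fderiv ℝ θ x (φ.velocity x) + θ x * deriv (fun t => φ.jac t x) 0) 0 := fun x => by
    have h := (φ.hasDerivAt_comp hθ x).fun_mul (φ.hasDerivAt_jac x)
    rwa [φ.jac_zero, φ.zero, mul_one] at h
  have h1 := hasDerivAt_integral_of_eq_off_compact (μ := volume)
    (H := fun t x => θ (φ.toFun t x) * φ.jac t x)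
    one_pos (((hθ.comp φ.smooth).mul φ.contDiff_jac).of_le (by simp)).contDiffOn
    φ.isCompact_support
    (fun t _ x hx => by simp only [φ.toFun_of_notMem _ hx, φ.jac_of_notMem _ hx])
    (by simpa only [φ.zero, φ.jac_zero, mul_one] using hint)
  simp only [(hd _).deriv] at h1
  refine ⟨h1.1, h1.2.unique ((hasDerivAt_const (0 : ℝ) (∫ x, θ x)).congr_of_eventuallyEq ?_)⟩
  filter_upwards [Metric.ball_mem_nhds 0 hδ] with t ht
  obtain ⟨hpos, e, he⟩ := h t ht
  have hcv := integral_image_eq_integral_abs_det_fderiv_smul volume MeasurableSet.univ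
    (fun x _ => (φ.hasFDerivAt_slice t x).hasFDerivWithinAt) (by rw [← he]; exact e.injective.injOn) θ
  rw [image_univ, ← he, e.surjective.range_eq, he] at hcv
  simp only [Measure.restrict_univ] at hcv
  rw [hcv]
  refine integral_congr_ae (.of_forall fun x => ?_)
  have : |(fderiv ℝ (φ.toFun t) x).det| = φ.jac t x := abs_of_pos (hpos x)
  simp only [this, smul_eq_mul, mul_comm]

/-- The pullback of a density by `φ_t`. -/
lemma map_withDensity_pullback (ρ : Coord n → ℝ) {t : ℝ}
    (hpos : ∀ x, 0 < φ.jac t x) (e : Coord n ≃ₜ Coord n) (he : ⇑e = φ.toFun t) :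
    (volume.withDensity fun x => ENNReal.ofReal (ρ (φ.toFun t x) * φ.jac t x)).map (φ.toFun t)
      = volume.withDensity fun x => ENNReal.ofReal (ρ x) := by
  ext s hs
  have hm := (φ.continuous_toFun t).measurable
  rw [Measure.map_apply hm hs, withDensity_apply _ (hm hs), withDensity_apply _ hs]
  have hcv := lintegral_image_eq_lintegral_abs_det_fderiv_mul volume (hm hs)
    (fun x _ => (φ.hasFDerivAt_slice t x).hasFDerivWithinAt) (by rw [← he]; exact e.injective.injOn)
    (fun x => ENNReal.ofReal (ρ x))
  rw [image_preimage_eq s (by rw [← he]; exact e.surjective)] at hcv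
  rw [hcv]
  refine lintegral_congr fun x => ?_
  have : |(fderiv ℝ (φ.toFun t) x).det| = φ.jac t x := abs_of_pos (hpos x)
  rw [this, mul_comm, ENNReal.ofReal_mul (hpos x).le]

end Variation

end WassersteinPoisson

/-! ### First variation of the Kullback-Leibler divergence. -/

namespace WassersteinPoisson

open Filter Topology Set InformationTheory

variable {n : ℕ}

namespace IsSmoothPosDensity

variable {p q : ProbabilityMeasure (Coord n)} {ρ ρp ρq : Coord n → ℝ}

lemma integral_eq (hq : IsSmoothPosDensity q ρ) (f : Coord n → ℝ) :
    ∫ x, f x ∂(q : Measure (Coord n)) = ∫ x, ρ x * f x := by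
  rw [hq.2.2, integral_withDensity_eq_integral_toReal_smul
    hq.1.continuous.measurable.ennreal_ofReal (.of_forall fun _ => ENNReal.ofReal_lt_top)]
  simp only [ENNReal.toReal_ofReal (hq.2.1 _).le, smul_eq_mul]

lemma integrable_density (hq : IsSmoothPosDensity q ρ) : Integrable ρ volume := by
  refine ⟨hq.1.continuous.aestronglyMeasurable, ?_⟩
  rw [hasFiniteIntegral_iff_ofReal (.of_forall fun x => (hq.2.1 x).le)]
  have : (q : Measure (Coord n)) univ < ⊤ := measure_lt_top _ _
  rwa [hq.2.2, withDensity_apply _ MeasurableSet.univ, Measure.restrict_univ] at this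

lemma contDiff_log_div (hp : IsSmoothPosDensity p ρp) (hq : IsSmoothPosDensity q ρq) :
    ContDiff ℝ ∞ fun x => Real.log (ρq x / ρp x) :=
  (hq.1.div hp.1 fun x => (hp.2.1 x).ne').log fun x => (div_pos (hq.2.1 x) (hp.2.1 x)).ne'

/-- Finite divergence includes integrability of the log-likelihood ratio, which for these densities
is the logarithm of their quotient. -/
lemma integrable_log_div (hp : IsSmoothPosDensity p ρp) (hq : IsSmoothPosDensity q ρq)
    (hKL : klDiv (q : Measure (Coord n)) (p : Measure (Coord n)) ≠ ⊤) :
    Integrable (fun x => Real.log (ρq x / ρp x)) (q : Measure (Coord n)) := by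
  refine (klDiv_ne_top_iff.1 hKL).2.congr ?_
  rw [hq.2.2, hp.2.2]
  exact (llr_withDensity_ofReal hq.1.continuous.measurable hp.1.continuous.measurable
    hq.2.1 hp.2.1).2

/-- Pulling back to the reference measure, the divergence of `(φ_t)_# q` from `p` becomes an
integral with respect to `q`. -/
lemma KL_curve (hp : IsSmoothPosDensity p ρp) (hq : IsSmoothPosDensity q ρq) (φ : Variation n)
    {t : ℝ} (hpos : ∀ x, 0 < φ.jac t x) (e : Coord n ≃ₜ Coord n) (he : ⇑e = φ.toFun t) :
    KL p (φ.curve q t) =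
      ∫ x, Real.log (ρq x / (ρp (φ.toFun t x) * φ.jac t x)) ∂(q : Measure (Coord n)) := by
  -- b is the density of the pullback p' of p. Since φ_t carries (q, p') to (φ_t# q, p), invariance
  -- of the divergence leaves an integral against the fixed measure q.
  set b : Coord n → ℝ := fun x => ρp (φ.toFun t x) * φ.jac t x with hb
  set p' : Measure (Coord n) := volume.withDensity fun x => ENNReal.ofReal (b x) with hp'
  have hm := (φ.continuous_toFun t).measurable
  have hmap : p'.map (φ.toFun t) = p := by
    rw [hp', hb, φ.map_withDensity_pullback ρp hpos e he, hp.2.2]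
  have hprob : IsProbabilityMeasure p' := by
    constructor
    have : (p : Measure (Coord n)) univ = 1 := measure_univ
    rwa [← hmap, Measure.map_apply hm MeasurableSet.univ, preimage_univ] at this
  have hbm : Measurable b := by
    have : Continuous fun x => φ.jac t x :=
      φ.contDiff_jac.continuous.comp (continuous_const.prodMk continuous_id)
    exact ((hp.1.continuous.comp (φ.continuous_toFun t)).mul this).measurable
  obtain ⟨hac, hllr⟩ := llr_withDensity_ofReal (μ := volume) hq.1.continuous.measurable hbm hq.2.1
    fun x => mul_pos (hp.2.1 _) (hpos x)
  rw [← hq.2.2] at hac hllr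
  have hkl := klDiv_map_measurableEquiv (q : Measure (Coord n)) p' e.toMeasurableEquiv
  rw [Homeomorph.toMeasurableEquiv_coe, he, hmap] at hkl
  have hcurve : ((φ.curve q t : ProbabilityMeasure (Coord n)) : Measure (Coord n))
      = (q : Measure (Coord n)).map (φ.toFun t) := rfl
  -- Both measures have mass 1, so the mass correction in `klDiv` cancels; no integrability is
  -- needed for this identity.
  rw [KL, hcurve, hkl, toReal_klDiv_of_measure_eq hac (by simp)]
  exact integral_congr_ae hllr

/-- The derivative of the divergence along a variation. -/
lemma hasDerivAt_KL_curve (hp : IsSmoothPosDensity p ρp) (hq : IsSmoothPosDensity q ρq)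
    (hKL : klDiv (q : Measure (Coord n)) (p : Measure (Coord n)) ≠ ⊤) (φ : Variation n) :
    HasDerivAt (fun t => KL p (φ.curve q t))
      (∫ x, fderiv ℝ (fun x => Real.log (ρq x / ρp x)) x (φ.velocity x)
        ∂(q : Measure (Coord n))) 0 := by
  obtain ⟨δ, hδ, h⟩ := φ.exists_homeomorph
  have hv : ∀ t ∈ Metric.ball (0 : ℝ) δ, ∀ x, 0 < ρp (φ.toFun t x) * φ.jac t x :=
    fun t ht x => mul_pos (hp.2.1 _) ((h t ht).1 x)
  have hD := hasDerivAt_integral_of_eq_off_compact (μ := (q : Measure (Coord n)))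
    (H := fun t x => Real.log (ρq x / (ρp (φ.toFun t x) * φ.jac t x))) hδ
    (by
      refine ContDiffOn.log (ContDiffOn.div ?_ ?_ fun z hz => (hv _ hz.1 _).ne')
        fun z hz => (div_pos (hq.2.1 _) (hv _ hz.1 _)).ne'
      · exact ((hq.1.comp contDiff_snd).of_le (by simp)).contDiffOn
      · exact (((hp.1.comp φ.smooth).mul φ.contDiff_jac).of_le (by simp)).contDiffOn)
    φ.isCompact_support
    (fun t _ x hx => by simp only [φ.toFun_of_notMem _ hx, φ.jac_of_notMem _ hx])
    (by simpa only [φ.zero, φ.jac_zero, mul_one] using hp.integrable_log_div hq hKL)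
  have hd : ∀ x, deriv (fun t => Real.log (ρq x / (ρp (φ.toFun t x) * φ.jac t x))) 0
      = -(fderiv ℝ ρp x (φ.velocity x) / ρp x) - deriv (fun t => φ.jac t x) 0 := fun x => by
    have h1 := ((φ.hasDerivAt_comp hp.1 x).fun_mul (φ.hasDerivAt_jac x))
    have h0 : ρp (φ.toFun 0 x) * φ.jac 0 x ≠ 0 := (hv 0 (Metric.mem_ball_self hδ) x).ne'
    have h2 := (((hasDerivAt_const (0 : ℝ) (ρq x)).fun_div h1 h0).log
      (div_pos (hq.2.1 x) (hv 0 (Metric.mem_ball_self hδ) x)).ne').deriv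
    rw [h2, φ.jac_zero, φ.zero]
    have := (hp.2.1 x).ne'
    have := (hq.2.1 x).ne'
    field_simp
    ring
  have hu : ∀ x, fderiv ℝ (fun x => Real.log (ρq x / ρp x)) x (φ.velocity x)
      = fderiv ℝ ρq x (φ.velocity x) / ρq x - fderiv ℝ ρp x (φ.velocity x) / ρp x := fun x => by
    have hq' := (hq.2.1 x).ne'
    have hp' := (hp.2.1 x).ne'
    have hqd := (hq.1.differentiable (by simp) x)
    have hpd := (hp.1.differentiable (by simp) x)
    have heq : (fun x => Real.log (ρq x / ρp x)) = fun x => Real.log (ρq x) - Real.log (ρp x) :=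
      funext fun y => Real.log_div (hq.2.1 y).ne' (hp.2.1 y).ne'
    rw [heq, ((hqd.hasFDerivAt.log hq').fun_sub (hpd.hasFDerivAt.log hp')).fderiv]
    simp only [sub_apply, smul_apply, smul_eq_mul]
    ring
  have hui : Integrable (fun x => fderiv ℝ (fun x => Real.log (ρq x / ρp x)) x (φ.velocity x))
      (q : Measure (Coord n)) := by
    refine Continuous.integrable_of_hasCompactSupport
      (((hp.contDiff_log_div hq).continuous_fderiv (by simp)).clm_apply φ.continuous_velocity) ?_
    refine φ.hasCompactSupport_velocity.mono fun x hx h0 => hx ?_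
    simp [h0]
  -- The two integrands differ by dρq(X)/ρq plus the derivative of the Jacobian. Multiplied by ρq
  -- this is the integrand of `integral_fderiv_velocity_add` for θ = ρq, whose integral is 0.
  have hval : ∫ x, deriv (fun t => Real.log (ρq x / (ρp (φ.toFun t x) * φ.jac t x))) 0
        ∂(q : Measure (Coord n))
      = ∫ x, fderiv ℝ (fun x => Real.log (ρq x / ρp x)) x (φ.velocity x)
        ∂(q : Measure (Coord n)) := by
    rw [eq_comm, ← sub_eq_zero, ← integral_sub hui hD.1, hq.integral_eq]
    refine Eq.trans ?_ (φ.integral_fderiv_velocity_add hq.1 hq.integrable_density).2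
    refine integral_congr_ae (.of_forall fun x => ?_)
    have := (hq.2.1 x).ne'
    simp only [hd, hu]
    field_simp
    ring
  rw [← hval]
  refine hD.2.congr_of_eventuallyEq ?_
  filter_upwards [Metric.ball_mem_nhds 0 hδ] with t ht
  obtain ⟨hpos, e, he⟩ := h t ht
  exact hp.KL_curve hq φ hpos e he

end IsSmoothPosDensity

end WassersteinPoisson

/-! ### Gradients of functions on the space of probability measures. -/

namespace WassersteinPoisson

open Filter Topology Set

variable {n : ℕ}

lemma fderiv_eq_sum_partialDeriv (f : Coord n → ℝ) (x v : Coord n) :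
    fderiv ℝ f x v = ∑ i, v i * partialDeriv i f x := by
  conv_lhs => rw [← (EuclideanSpace.basisFun (Fin n) ℝ).sum_repr v]
  simp [partialDeriv]

/-- With f in the second slot of the bracket, contracting βⁱʲ∂ⱼf with ∂ᵢh produces no sign; this
matches the convention X_f = {·, f}. -/
lemma PoissonStructure.fderiv_coordField (β : PoissonStructure n) (f h : Coord n → ℝ)
    (x : Coord n) : fderiv ℝ h x (β.coordField f x) = β.bracket h f x := by
  rw [fderiv_eq_sum_partialDeriv]
  simp only [PoissonStructure.coordField, PoissonStructure.bracket, Finset.sum_mul]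
  exact Finset.sum_congr rfl fun i _ => Finset.sum_congr rfl fun j _ => by ring

lemma contDiff_partialDeriv {f : Coord n → ℝ} (hf : ContDiff ℝ ∞ f) (j : Fin n) :
    ContDiff ℝ ∞ (partialDeriv j f) :=
  (hf.fderiv_right (m := ∞) (by simp)).clm_apply contDiff_const

namespace RiemannianStructure

variable (g : RiemannianStructure n)

/-- The inverse matrix in `grad` cancels the matrix in `ip`. Most later gradient computations use
this duality instead of coordinates. -/
lemma ip_grad (f : Coord n → ℝ) (x v : Coord n) : g.ip x v (g.grad f x) = fderiv ℝ f x v := by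
  have h := g.ip_mulVec_inv x v (WithLp.toLp 2 fun j => partialDeriv j f x)
  rw [fderiv_eq_sum_partialDeriv]
  exact h

lemma ip_grad_left (f : Coord n → ℝ) (x v : Coord n) : g.ip x (g.grad f x) v = fderiv ℝ f x v := by
  rw [ip_comm, ip_grad]

/-- Test with v = u - w. This turns identities between differentials into identities between
gradients. -/
lemma eq_of_forall_ip_eq {x u w : Coord n} (h : ∀ v, g.ip x v u = g.ip x v w) : u = w := by
  by_contra hne
  have hpos := g.ip_self_pos x (sub_ne_zero.2 hne)
  have h1 := h (u - w)
  rw [sub_eq_add_neg, ← neg_one_smul ℝ w] at hpos h1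
  rw [ip_add_right, ip_smul_right] at hpos
  linarith

/-- Cramer's rule: an entry of the inverse is a quotient of determinants of matrices with smooth
entries, with nonvanishing denominator. -/
lemma contDiff_inv_coeff (i j : Fin n) : ContDiff ℝ ∞ fun x => (g.coeff x)⁻¹ i j := by
  have hd : ∀ x, (g.coeff x).det ≠ 0 := fun x => (g.posDef x).det_pos.ne'
  have hdet : ∀ B : Coord n → Matrix (Fin n) (Fin n) ℝ, (∀ i j, ContDiff ℝ ∞ fun x => B x i j) →
      ContDiff ℝ ∞ fun x => (B x).det := fun B hB => by
    simp only [Matrix.det_apply']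
    exact ContDiff.sum fun σ _ => contDiff_const.mul (contDiff_prod fun i _ => hB _ _)
  have h : (fun x => (g.coeff x)⁻¹ i j)
      = fun x => ((g.coeff x).det)⁻¹ * ((g.coeff x).updateRow j (Pi.single i 1)).det := by
    funext x
    simp [Matrix.inv_def, Matrix.adjugate_apply]
  rw [h]
  refine ((hdet _ g.smooth).inv hd).mul (hdet _ fun k l => ?_)
  simp only [Matrix.updateRow_apply]
  split_ifs
  · exact contDiff_const
  · exact g.smooth k l

lemma contDiff_grad {f : Coord n → ℝ} (hf : ContDiff ℝ ∞ f) : ContDiff ℝ ∞ (g.grad f) := by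
  rw [contDiff_euclidean]
  intro i
  have h : ContDiff ℝ ∞ fun x => ∑ j, (g.coeff x)⁻¹ i j * partialDeriv j f x :=
    ContDiff.sum fun j _ => (g.contDiff_inv_coeff i j).mul (contDiff_partialDeriv hf j)
  exact h

lemma hasCompactSupport_grad {f : Coord n → ℝ} (hf : HasCompactSupport f) :
    HasCompactSupport (g.grad f) := by
  refine (hf.fderiv ℝ).mono fun x hx h0 => hx ?_
  refine g.eq_of_forall_ip_eq (x := x) fun v => ?_
  rw [ip_grad, h0]
  simp [ip]

lemma memL2_grad (q : Measure (Coord n)) [IsFiniteMeasure q] {f : Coord n → ℝ}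
    (hf : ContDiff ℝ ∞ f) (hc : HasCompactSupport f) : g.MemL2 q (g.grad f) :=
  g.memL2_of_hasCompactSupport q (g.contDiff_grad hf).continuous (g.hasCompactSupport_grad hc)

end RiemannianStructure

/-- The straight-line variation with a given compactly supported velocity field. -/
noncomputable def Variation.ofField (X : Coord n → Coord n) (hX : ContDiff ℝ ∞ X)
    (hc : HasCompactSupport X) : Variation n where
  -- A `Variation` need not consist of diffeomorphisms for all t, so no flow of X has to be
  -- constructed.
  toFun t x := x + t • X x
  smooth := contDiff_snd.add (contDiff_fst.smul (hX.comp contDiff_snd))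
  zero x := by simp
  eq_outside := ⟨tsupport X, hc, fun t x hx => by simp [image_eq_zero_of_notMem_tsupport hx]⟩

lemma Variation.velocity_ofField (X : Coord n → Coord n) (hX : ContDiff ℝ ∞ X)
    (hc : HasCompactSupport X) : (Variation.ofField X hX hc).velocity = X := by
  funext x
  have : HasDerivAt (fun t : ℝ => x + t • X x) ((1 : ℝ) • X x) 0 :=
    ((hasDerivAt_id (0 : ℝ)).smul_const (X x)).const_add x
  rw [one_smul] at this
  exact this.deriv

lemma inner_mk {g : RiemannianStructure n} {q : Measure (Coord n)} (v : L2Field g q)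
    {X : Coord n → Coord n} (hX : g.MemL2 q X) :
    inner ℝ v (L2Field.mk X hX) = ∫ x, g.ip x (v.fn x) (X x) ∂q := by
  rw [L2Field.inner_def]
  refine integral_congr_ae ?_
  filter_upwards [L2Field.fn_mk X hX] with x hx
  rw [hx]

/-- The orthogonal projection is self-adjoint and fixes tangent vectors. -/
lemma inner_tangentProj {g : RiemannianStructure n} {q : Measure (Coord n)} {v : L2Field g q}
    (hv : v ∈ tangentSpace g q) (X : L2Field g q) : inner ℝ v (tangentProj g q X) = inner ℝ v X := by
  rw [tangentProj, ← Submodule.inner_starProjection_left_eq_right,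
    Submodule.starProjection_eq_self_iff.2 hv]

lemma tangentProj_mem (g : RiemannianStructure n) (q : Measure (Coord n)) (X : L2Field g q) :
    tangentProj g q X ∈ tangentSpace g q :=
  Submodule.starProjection_apply_mem _ _

lemma mem_tangentSpace_of_grad {g : RiemannianStructure n} {q : Measure (Coord n)}
    {Y : L2Field g q} {f : Coord n → ℝ} (hf : ContDiff ℝ ∞ f) (hc : HasCompactSupport f)
    (hY : Y.fn =ᵐ[q] g.grad f) : Y ∈ tangentSpace g q :=
  Submodule.le_topologicalClosure _ (Submodule.subset_span ⟨f, hf, hc, hY⟩)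

/-- A tangent vector is determined by its pairings with gradients of test functions. -/
lemma eq_of_forall_inner_grad {g : RiemannianStructure n} {q : Measure (Coord n)}
    {v w : L2Field g q} (hv : v ∈ tangentSpace g q) (hw : w ∈ tangentSpace g q)
    (h : ∀ (f : Coord n → ℝ) (Y : L2Field g q), ContDiff ℝ ∞ f → HasCompactSupport f →
      Y.fn =ᵐ[q] g.grad f → inner ℝ Y v = inner ℝ Y w) : v = w := by
  rw [← sub_eq_zero]
  set S := {Y : L2Field g q | ∃ f : Coord n → ℝ,
    ContDiff ℝ ∞ f ∧ HasCompactSupport f ∧ Y.fn =ᵐ[q] g.grad f}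
  have h1 : v - w ∈ (Submodule.span ℝ S)ᗮ := by
    rw [Submodule.mem_orthogonal]
    intro u hu
    induction hu using Submodule.span_induction with
    | mem Y hY =>
      obtain ⟨f, hf, hc, hY⟩ := hY
      rw [inner_sub_right, h f Y hf hc hY, sub_self]
    | zero => exact inner_zero_left _
    | add a b _ _ ha hb => rw [inner_add_left, ha, hb, add_zero]
    | smul c a _ ha => rw [inner_smul_left, ha, mul_zero]
  -- A subspace and its closure have the same orthogonal complement, so v - w is both tangent and
  -- orthogonal to the tangent space.
  have h2 : v - w ∈ (tangentSpace g q)ᗮ := by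
    rw [tangentSpace, Submodule.orthogonal_closure]; exact h1
  have h3 : v - w ∈ tangentSpace g q := Submodule.sub_mem _ hv hw
  exact inner_self_eq_zero (𝕜 := ℝ).1 ((Submodule.mem_orthogonal _ _).1 h2 _ h3)

section Gradients

variable {g : RiemannianStructure n} {q : ProbabilityMeasure (Coord n)}

lemma inner_tangentVector {v : L2Field g (q : Measure (Coord n))}
    (hv : v ∈ tangentSpace g (q : Measure (Coord n))) (φ : Variation n) :
    inner ℝ v (φ.tangentVector g q)
      = ∫ x, g.ip x (v.fn x) (φ.velocity x) ∂(q : Measure (Coord n)) := by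
  rw [Variation.tangentVector, inner_tangentProj hv, inner_mk]

lemma linearFunctional_curve {f : Coord n → ℝ} (hf : Continuous f) (φ : Variation n) (t : ℝ) :
    linearFunctional f (φ.curve q t) = ∫ x, f (φ.toFun t x) ∂(q : Measure (Coord n)) := by
  have : ((φ.curve q t : ProbabilityMeasure (Coord n)) : Measure (Coord n))
      = (q : Measure (Coord n)).map (φ.toFun t) := rfl
  rw [linearFunctional, this, integral_map (φ.continuous_toFun t).aemeasurable
    hf.aestronglyMeasurable]

lemma inner_mk_grad_tangentVector {f : Coord n → ℝ} (hg : g.MemL2 q (g.grad f))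
    (ht : L2Field.mk _ hg ∈ tangentSpace g (q : Measure (Coord n))) (φ : Variation n) :
    inner ℝ (L2Field.mk _ hg) (φ.tangentVector g q)
      = ∫ x, fderiv ℝ f x (φ.velocity x) ∂(q : Measure (Coord n)) := by
  rw [inner_tangentVector ht]
  refine integral_congr_ae ?_
  filter_upwards [L2Field.fn_mk _ hg] with x hx
  rw [hx, g.ip_grad_left]

lemma hasDerivAt_linearFunctional_curve {f : Coord n → ℝ} (hf : ContDiff ℝ ∞ f)
    (hint : Integrable f (q : Measure (Coord n))) (φ : Variation n) :
    HasDerivAt (fun t => linearFunctional f (φ.curve q t))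
      (∫ x, fderiv ℝ f x (φ.velocity x) ∂(q : Measure (Coord n))) 0 := by
  simpa only [linearFunctional_curve hf.continuous] using φ.hasDerivAt_integral_comp hf hint

/-- The gradient of a linear functional. -/
lemma hasGradientAt_linearFunctional {f : Coord n → ℝ} (hf : ContDiff ℝ ∞ f)
    (hint : Integrable f (q : Measure (Coord n))) (hg : g.MemL2 q (g.grad f))
    (ht : L2Field.mk _ hg ∈ tangentSpace g (q : Measure (Coord n))) :
    HasGradientAt g (linearFunctional f) q (L2Field.mk _ hg) :=
  ⟨ht, fun φ => by
    rw [inner_mk_grad_tangentVector hg ht]; exact hasDerivAt_linearFunctional_curve hf hint φ⟩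

/-- Gradients on the space of probability measures are unique. -/
lemma HasGradientAt.unique {F : ProbabilityMeasure (Coord n) → ℝ}
    {v w : L2Field g (q : Measure (Coord n))} (hv : HasGradientAt g F q v)
    (hw : HasGradientAt g F q w) : v = w := by
  refine eq_of_forall_inner_grad hv.1 hw.1 fun f Y hf hc hY => ?_
  -- A variation with velocity grad f makes the derivative of F determine the pairing of a gradient
  -- of F with grad f.
  set φ := Variation.ofField (g.grad f) (g.contDiff_grad hf) (g.hasCompactSupport_grad hc) with hφ
  have h := (hv.2 φ).unique (hw.2 φ)
  rw [inner_tangentVector hv.1, inner_tangentVector hw.1, hφ, Variation.velocity_ofField] at h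
  have hi : ∀ u : L2Field g (q : Measure (Coord n)),
      inner ℝ Y u = ∫ x, g.ip x (u.fn x) (g.grad f x) ∂(q : Measure (Coord n)) := fun u => by
    rw [real_inner_comm, L2Field.inner_def]
    refine integral_congr_ae ?_
    filter_upwards [hY] with x hx
    rw [hx]
  rw [hi, hi, h]

/-- The gradient of a linear functional, if it exists, is the gradient of its integrand. -/
lemma HasGradientAt.fn_ae_eq_grad {f : Coord n → ℝ} {v : L2Field g (q : Measure (Coord n))}
    (hv : HasGradientAt g (linearFunctional f) q v) (hf : ContDiff ℝ ∞ f)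
    (hint : Integrable f (q : Measure (Coord n))) :
    v.fn =ᵐ[(q : Measure (Coord n))] g.grad f := by
  -- As v is tangent, the projection of the velocity can be dropped, so v is tested against all
  -- compactly supported smooth fields X, not only gradients. Square integrability of grad f is not
  -- assumed.
  have hXint : ∀ (X : Coord n → Coord n), ContDiff ℝ ∞ X → HasCompactSupport X →
      Integrable (fun x => g.ip x (v.fn x) (X x)) (q : Measure (Coord n)) ∧ Integrable (fun x => fderiv ℝ f x (X x)) (q : Measure (Coord n)) ∧
      ∫ x, (g.ip x (v.fn x) (X x) - fderiv ℝ f x (X x)) ∂(q : Measure (Coord n)) = 0 := by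
    intro X hX hc
    have h1 : Integrable (fun x => g.ip x (v.fn x) (X x)) (q : Measure (Coord n)) :=
      v.memL2_fn.integrable_ip (g.memL2_of_hasCompactSupport (q : Measure (Coord n)) hX.continuous hc)
    have h2 : Integrable (fun x => fderiv ℝ f x (X x)) (q : Measure (Coord n)) := by
      refine Continuous.integrable_of_hasCompactSupport
        ((hf.continuous_fderiv (by simp)).clm_apply hX.continuous) (hc.mono fun x hx h0 => hx ?_)
      simp [h0]
    refine ⟨h1, h2, ?_⟩
    have h := (hv.2 (Variation.ofField X hX hc)).unique
      (hasDerivAt_linearFunctional_curve hf hint (Variation.ofField X hX hc))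
    rw [inner_tangentVector hv.1, Variation.velocity_ofField] at h
    rw [integral_sub h1 h2, h, sub_self]
  -- Fields X = ψ eᵢ with ψ a test function reduce the claim to the fundamental lemma of the
  -- calculus of variations, one component at a time.
  have hcomp : ∀ i : Fin n, ∀ᵐ x ∂(q : Measure (Coord n)), g.ip x (v.fn x) (EuclideanSpace.single i 1)
      - fderiv ℝ f x (EuclideanSpace.single i 1) = 0 := by
    intro i
    have hψ : ∀ ψ : Coord n → ℝ, ContDiff ℝ ∞ ψ → HasCompactSupport ψ →
        Integrable (fun x => ψ x • (g.ip x (v.fn x) (EuclideanSpace.single i 1)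
          - fderiv ℝ f x (EuclideanSpace.single i 1))) (q : Measure (Coord n)) ∧
        ∫ x, ψ x • (g.ip x (v.fn x) (EuclideanSpace.single i 1)
          - fderiv ℝ f x (EuclideanSpace.single i 1)) ∂(q : Measure (Coord n)) = 0 := by
      intro ψ hψ hc
      have := hXint (fun x => ψ x • EuclideanSpace.single i 1) (hψ.smul contDiff_const)
        (hc.smul_right)
      simp only [g.ip_smul_right, map_smul, smul_eq_mul, ← mul_sub] at this
      refine ⟨?_, this.2.2⟩
      have h := this.1.sub this.2.1
      refine h.congr (.of_forall fun x => ?_)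
      simp only [Pi.sub_apply, smul_eq_mul, mul_sub]
    refine ae_eq_zero_of_integral_contDiff_smul_eq_zero ?_ fun ψ h1 h2 => (hψ ψ h1 h2).2
    rw [locallyIntegrable_iff]
    intro K hK
    -- Integrability on K is read off from the case where ψ is a bump function equal to 1 on K.
    obtain ⟨R, hR, hKR⟩ := hK.isBounded.subset_closedBall_lt 0 0
    let ψ : ContDiffBump (0 : Coord n) := ⟨R, R + 1, hR, by linarith⟩
    have := (hψ ψ ψ.contDiff ψ.hasCompactSupport).1.integrableOn (s := K)
    refine this.congr_fun ?_ hK.measurableSet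
    intro x hx
    simp [ψ.one_of_mem_closedBall (hKR hx)]
  filter_upwards [ae_all_iff.2 hcomp] with x hx
  refine g.eq_of_forall_ip_eq (x := x) fun u => ?_
  have hsum : g.ip x (v.fn x) u
      = ∑ i, u i * g.ip x (v.fn x) (EuclideanSpace.single i 1) := by
    simp [RiemannianStructure.ip, Finset.mul_sum]
    rw [Finset.sum_comm]
    exact Finset.sum_congr rfl fun i _ => Finset.sum_congr rfl fun j _ => by ring
  rw [g.ip_grad, g.ip_comm, hsum, fderiv_eq_sum_partialDeriv]
  refine Finset.sum_congr rfl fun i _ => ?_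
  rw [sub_eq_zero.1 (hx i), partialDeriv]

end Gradients

end WassersteinPoisson

/-! ### The geodesic distance and local comparison of metrics. -/

namespace WassersteinPoisson

open Filter Topology Set

variable {n : ℕ}

namespace RiemannianStructure

variable (g : RiemannianStructure n)

lemma sqrt_ip_smul (x : Coord n) (c : ℝ) (v : Coord n) :
    √(g.ip x (c • v) (c • v)) = |c| * √(g.ip x v v) := by
  rw [ip_smul_left, ip_smul_right, ← mul_assoc, Real.sqrt_mul (mul_self_nonneg c),
    Real.sqrt_mul_self_eq_abs]

/-- The `g`-norm on the tangent spaces. -/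
@[reducible] noncomputable def tangentENorm (z : Coord n) : ENorm (TangentSpace 𝓘(ℝ, Coord n) z) :=
  ⟨fun v : Coord n => ENNReal.ofReal (√(g.ip z v v))⟩

/-- Homogeneity of the norm makes path length invariant under reparametrization, on which symmetry
and the triangle inequality for `edist` rest. -/
lemma enormSMulClass (z : Coord n) :
    letI := g.tangentENorm z
    ENormSMulClass ℝ (TangentSpace 𝓘(ℝ, Coord n) z) := by
  let := g.tangentENorm z
  have h : ∀ (c : ℝ) (v : Coord n), ENNReal.ofReal (√(g.ip z (c • v) (c • v))) =
      ‖c‖ₑ * ENNReal.ofReal (√(g.ip z v v)) := fun c v => by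
    rw [sqrt_ip_smul, ENNReal.ofReal_mul (abs_nonneg c), Real.enorm_eq_ofReal_abs]
  exact ⟨h⟩

lemma edist_triangle (x y z : Coord n) : g.edist x z ≤ g.edist x y + g.edist y z := by
  let := g.tangentENorm
  have : ∀ z, ENormSMulClass ℝ (TangentSpace 𝓘(ℝ, Coord n) z) := g.enormSMulClass
  have h : Manifold.riemannianEDist 𝓘(ℝ, Coord n) x z ≤
      Manifold.riemannianEDist 𝓘(ℝ, Coord n) x y + Manifold.riemannianEDist 𝓘(ℝ, Coord n) y z :=
    Manifold.riemannianEDist_triangle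
  exact h

lemma edist_comm (x y : Coord n) : g.edist x y = g.edist y x := by
  let := g.tangentENorm
  have : ∀ z, ENormSMulClass ℝ (TangentSpace 𝓘(ℝ, Coord n) z) := g.enormSMulClass
  have h : Manifold.riemannianEDist 𝓘(ℝ, Coord n) x y = Manifold.riemannianEDist 𝓘(ℝ, Coord n) y x :=
    Manifold.riemannianEDist_comm
  exact h

/-- The geodesic distance is at most the length of the straight segment. -/
lemma edist_le_of_segment {x y : Coord n} {C : ℝ}
    (h : ∀ t ∈ Icc (0 : ℝ) 1, √(g.ip (x + t • (y - x)) (y - x) (y - x)) ≤ C) :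
    g.edist x y ≤ ENNReal.ofReal C := by
  let := g.tangentENorm
  have : ∀ z, ENormSMulClass ℝ (TangentSpace 𝓘(ℝ, Coord n) z) := g.enormSMulClass
  set γ : ℝ → Coord n := fun t => x + t • (y - x) with hγ
  have hγd : ∀ t, HasDerivAt γ (y - x) t := fun t => by
    have := ((hasDerivAt_id t).smul_const (y - x)).const_add x
    rwa [one_smul] at this
  have hs : ContMDiffOn 𝓘(ℝ, ℝ) 𝓘(ℝ, Coord n) 1 γ (Icc 0 1) := by
    rw [contMDiffOn_iff_contDiffOn]
    exact (contDiff_const.add (contDiff_id.smul contDiff_const)).contDiffOn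
  have h1 : Manifold.riemannianEDist 𝓘(ℝ, Coord n) x y ≤ Manifold.pathELength 𝓘(ℝ, Coord n) γ 0 1 :=
    Manifold.riemannianEDist_le_pathELength hs (by simp [hγ]) (by simp [hγ]) zero_le_one
  refine le_trans (b := Manifold.pathELength 𝓘(ℝ, Coord n) γ 0 1) h1 ?_
  rw [Manifold.pathELength_eq_lintegral_mfderiv_Icc]
  calc _ ≤ ∫⁻ t in Icc (0 : ℝ) 1, ENNReal.ofReal C := by
        refine setLIntegral_mono measurable_const fun t ht => ?_
        rw [mfderiv_eq_fderiv]
        change ENNReal.ofReal (√(g.ip (γ t) (fderiv ℝ γ t 1) (fderiv ℝ γ t 1))) ≤ _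
        rw [(hγd t).hasFDerivAt.fderiv]
        simpa using ENNReal.ofReal_le_ofReal (h t ht)
    _ = ENNReal.ofReal C := by simp

/-- A continuous upper bound for the operator norm of `g`. -/
noncomputable def upBound (x : Coord n) : ℝ := ∑ i, ∑ j, |g.coeff x i j|

lemma abs_sum_mul_le (a : Fin n → Fin n → ℝ) (v : Coord n) :
    |∑ i, ∑ j, a i j * v i * v j| ≤ (∑ i, ∑ j, |a i j|) * ‖v‖ ^ 2 := by
  simp only [Finset.sum_mul]
  refine (Finset.abs_sum_le_sum_abs _ _).trans (Finset.sum_le_sum fun i _ => ?_)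
  refine (Finset.abs_sum_le_sum_abs _ _).trans (Finset.sum_le_sum fun j _ => ?_)
  have hi : |v.ofLp i| ≤ ‖v‖ := by simpa using PiLp.norm_apply_le v i
  have hj : |v.ofLp j| ≤ ‖v‖ := by simpa using PiLp.norm_apply_le v j
  rw [abs_mul, abs_mul, mul_assoc, sq]
  gcongr

lemma ip_le_upBound (x v : Coord n) : g.ip x v v ≤ g.upBound x * ‖v‖ ^ 2 :=
  (le_abs_self _).trans (abs_sum_mul_le _ v)

lemma continuous_upBound : Continuous g.upBound :=
  continuous_finsetSum _ fun i _ => continuous_finsetSum _ fun j _ => (g.continuous_coeff i j).abs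

lemma upBound_nonneg (x : Coord n) : 0 ≤ g.upBound x :=
  Finset.sum_nonneg fun _ _ => Finset.sum_nonneg fun _ _ => abs_nonneg _

/-- On bounded sets, the geodesic distance is controlled by the Euclidean one. -/
lemma exists_edist_le_on_closedBall (r : ℝ) : ∃ M : ℝ, 0 ≤ M ∧ ∀ x ∈ Metric.closedBall (0 : Coord n) r,
    ∀ y ∈ Metric.closedBall (0 : Coord n) r, g.edist x y ≤ ENNReal.ofReal (M * ‖y - x‖) := by
  obtain ⟨B, hB⟩ := (isCompact_closedBall (0 : Coord n) r).exists_bound_of_continuousOn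
    g.continuous_upBound.continuousOn
  -- B bounds `upBound` on the ball. By convexity the segment stays there, where the g-norm is at
  -- most √B times the Euclidean norm.
  refine ⟨√B, Real.sqrt_nonneg _, fun x hx y hy => g.edist_le_of_segment fun t ht => ?_⟩
  have hmem : x + t • (y - x) ∈ Metric.closedBall (0 : Coord n) r :=
    (convex_closedBall _ _).add_smul_sub_mem hx hy ht
  have hB' : g.upBound (x + t • (y - x)) ≤ B := (le_abs_self _).trans (hB _ hmem)
  have hB0 : 0 ≤ B := (g.upBound_nonneg _).trans hB'
  refine Real.sqrt_le_iff.2 ⟨by positivity, (g.ip_le_upBound _ _).trans ?_⟩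
  rw [mul_pow, Real.sq_sqrt hB0]
  gcongr

/-- The straight segment has finite length, which makes the real-valued `radius` meaningful. -/
lemma edist_ne_top (x y : Coord n) : g.edist x y ≠ ⊤ := by
  obtain ⟨M, -, h⟩ := g.exists_edist_le_on_closedBall (max ‖x‖ ‖y‖)
  exact ne_top_of_le_ne_top ENNReal.ofReal_ne_top (h x (by simp) y (by simp))

/-- The geodesic distance from the origin. -/
noncomputable def radius (x : Coord n) : ℝ := (g.edist 0 x).toReal

/-- The triangle inequality from the origin, used in both directions. -/
lemma abs_radius_sub_le {x y : Coord n} {C : ℝ} (hC : 0 ≤ C) (h : g.edist x y ≤ ENNReal.ofReal C) :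
    |g.radius x - g.radius y| ≤ C := by
  have key : ∀ a b : Coord n, g.edist b a ≤ ENNReal.ofReal C → g.radius a - g.radius b ≤ C := by
    intro a b hab
    have h1 := (g.edist_triangle 0 b a).trans (add_le_add_right hab _)
    have h2 := ENNReal.toReal_mono
      (ENNReal.add_ne_top.2 ⟨g.edist_ne_top 0 b, ENNReal.ofReal_ne_top⟩) h1
    rw [ENNReal.toReal_add (g.edist_ne_top 0 b) ENNReal.ofReal_ne_top, ENNReal.toReal_ofReal hC] at h2
    simp only [radius]
    linarith
  rw [abs_le]
  have h1 := key x y (by rwa [g.edist_comm])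
  have h2 := key y x h
  constructor <;> linarith

lemma continuous_radius : Continuous g.radius := by
  rw [continuous_iff_continuousAt]
  intro x
  obtain ⟨M, hM, h⟩ := g.exists_edist_le_on_closedBall (‖x‖ + 1)
  have hx : x ∈ Metric.closedBall (0 : Coord n) (‖x‖ + 1) := by simp
  rw [ContinuousAt, tendsto_iff_norm_sub_tendsto_zero]
  have hlim : Tendsto (fun y => M * ‖x - y‖) (𝓝 x) (𝓝 0) := by
    have : Continuous fun y => M * ‖x - y‖ := by fun_prop
    simpa using this.tendsto x
  refine squeeze_zero' (.of_forall fun _ => norm_nonneg _) ?_ hlim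
  filter_upwards [Metric.closedBall_mem_nhds x one_pos] with y hy
  refine g.abs_radius_sub_le (by positivity) (h y ?_ x hx)
  rw [mem_closedBall_zero_iff]
  rw [Metric.mem_closedBall, dist_eq_norm] at hy
  have := norm_le_norm_add_norm_sub' y x
  linarith [norm_sub_rev x y]

/-- Uniformly on compact sets, the metrics at nearby points are comparable. -/
lemma exists_ip_le_four_mul {K : Set (Coord n)} (hK : IsCompact K) :
    ∃ δ > 0, ∀ x ∈ K, ∀ y, ‖y - x‖ < δ → ∀ v, g.ip y v v ≤ 4 * g.ip x v v := by
  have hc : Continuous fun z : Coord n × Coord n =>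
      (∑ i, ∑ j, |g.coeff (z.2 + z.1) i j - g.coeff z.2 i j|) * g.invBound z.2 := by
    refine Continuous.mul (continuous_finsetSum _ fun i _ => continuous_finsetSum _ fun j _ => ?_)
      (g.continuous_invBound.comp continuous_snd)
    exact (((g.continuous_coeff i j).comp (continuous_snd.add continuous_fst)).sub
      ((g.continuous_coeff i j).comp continuous_snd)).abs
  -- This product bounds the relative increase of g(v, v) from x to x + w. It vanishes at w = 0, so
  -- it is below 3 near 0, uniformly on K, and 1 + 3 = 4.
  have hev : ∀ᶠ w in 𝓝 (0 : Coord n), ∀ x ∈ K,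
      (∑ i, ∑ j, |g.coeff (x + w) i j - g.coeff x i j|) * g.invBound x < 3 := by
    refine hK.eventually_forall_of_forall_eventually fun x _ => ?_
    have h := hc.tendsto ((0 : Coord n), x)
    simp only [add_zero, sub_self, abs_zero, Finset.sum_const_zero, zero_mul] at h
    exact h.eventually_lt_const (by norm_num)
  obtain ⟨δ, hδ, h⟩ := Metric.eventually_nhds_iff.1 hev
  refine ⟨δ, hδ, fun x hx y hy v => ?_⟩
  have h1 := h (y := y - x) (by simpa using hy) x hx
  rw [add_sub_cancel] at h1
  set S := ∑ i, ∑ j, |g.coeff y i j - g.coeff x i j| with hS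
  have hS0 : 0 ≤ S := Finset.sum_nonneg fun _ _ => Finset.sum_nonneg fun _ _ => abs_nonneg _
  have h2 : g.ip y v v - g.ip x v v ≤ S * ‖v‖ ^ 2 := by
    refine le_trans (le_of_eq ?_) ((le_abs_self _).trans
      (abs_sum_mul_le (fun i j => g.coeff y i j - g.coeff x i j) v))
    simp only [ip, ← Finset.sum_sub_distrib]
    exact Finset.sum_congr rfl fun i _ => Finset.sum_congr rfl fun j _ => by ring
  have h3 : S * ‖v‖ ^ 2 ≤ S * (g.invBound x * g.ip x v v) :=
    mul_le_mul_of_nonneg_left (g.norm_sq_le x v) hS0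
  have h4 : S * g.invBound x * g.ip x v v ≤ 3 * g.ip x v v :=
    mul_le_mul_of_nonneg_right h1.le (g.ip_self_nonneg x v)
  nlinarith

end RiemannianStructure

end WassersteinPoisson

/-! ### Cutoff functions, and tangency of gradients on complete manifolds. -/

namespace WassersteinPoisson

open Filter Topology Set

variable {n : ℕ}

namespace RiemannianStructure

variable (g : RiemannianStructure n)

/-- Taking v = grad f gives s ≤ C√s for the squared norm s of the gradient. -/
lemma ip_grad_self_le {f : Coord n → ℝ} {x : Coord n} {C : ℝ} (hC : 0 ≤ C)
    (h : ∀ v, |fderiv ℝ f x v| ≤ C * √(g.ip x v v)) :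
    g.ip x (g.grad f x) (g.grad f x) ≤ C ^ 2 := by
  set s := g.ip x (g.grad f x) (g.grad f x) with hs
  have hs0 : 0 ≤ s := g.ip_self_nonneg _ _
  have h1 : s ≤ C * √s := by
    have := (le_abs_self _).trans (h (g.grad f x))
    rwa [← g.ip_grad, ← hs] at this
  have h2 : √s * √s = s := Real.mul_self_sqrt hs0
  have h3 := Real.sqrt_nonneg s
  have h4 : √s ≤ C := by
    by_contra! hlt
    nlinarith
  calc s = √s ^ 2 := by rw [sq, h2]
    _ ≤ C ^ 2 := pow_le_pow_left₀ h3 h4 2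

/-- Mollifying a compactly supported function that is Lipschitz for the geodesic distance. -/
lemma exists_mollification {χ : Coord n → ℝ} (hχ : Continuous χ) (h01 : ∀ x, χ x ∈ Icc (0 : ℝ) 1)
    {ρ : ℝ} (hsupp : ∀ x, ρ < ‖x‖ → χ x = 0) {C : ℝ} (hC : 0 ≤ C)
    (hlip : ∀ x y : Coord n, ∀ D, 0 ≤ D → g.edist x y ≤ ENNReal.ofReal D → |χ x - χ y| ≤ C * D)
    {ε : ℝ} (hε : 0 < ε) :
    ∃ ψ : Coord n → ℝ, ContDiff ℝ ∞ ψ ∧ HasCompactSupport ψ ∧ (∀ x, ψ x ∈ Icc (0 : ℝ) 1) ∧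
      (∀ x, |ψ x - χ x| ≤ ε) ∧ ∀ x, g.ip x (g.grad ψ x) (g.grad ψ x) ≤ (2 * C) ^ 2 := by
  have hcs : HasCompactSupport χ := HasCompactSupport.intro (isCompact_closedBall 0 ρ)
    fun x hx => hsupp x (by simpa using hx)
  obtain ⟨δ₁, hδ₁, hcomp⟩ := g.exists_ip_le_four_mul (isCompact_closedBall (0 : Coord n) (ρ + 1))
  obtain ⟨δ₂, hδ₂, hunif⟩ := Metric.uniformContinuous_iff.1
    (hcs.uniformContinuous_of_continuous hχ) ε hε
  -- The bound 1 keeps ψ supported in the ball of radius ρ + 1; δ₁ / 2 leaves room for two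
  -- displacements, by z and along v, within the range of metric comparison; δ₂ gives the uniform
  -- error ε.
  set δ := min 1 (min (δ₁ / 2) δ₂) with hδ
  have hδ0 : 0 < δ := by positivity
  have hδ1 : δ ≤ 1 := min_le_left _ _
  have hδδ₁ : δ ≤ δ₁ / 2 := (min_le_right _ _).trans (min_le_left _ _)
  have hδδ₂ : δ ≤ δ₂ := (min_le_right _ _).trans (min_le_right _ _)
  let b : ContDiffBump (0 : Coord n) := ⟨δ / 2, δ, half_pos hδ0, half_lt_self hδ0⟩
  set η : Coord n → ℝ := b.normed volume with hη
  have hη0 : ∀ z, 0 ≤ η z := b.nonneg_normed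
  have hηsupp : ∀ z, δ ≤ ‖z‖ → η z = 0 := fun z hz => by
    have h : z ∉ Function.support η := by
      rw [hη, b.support_normed_eq]
      simpa [b] using hz
    simpa using h
  have hηint : Integrable η volume := b.integrable_normed
  have hη1 : ∫ z, η z = 1 := b.integral_normed
  set ψ : Coord n → ℝ := fun x => ∫ z, η z * χ (x - z) with hψ
  have hconv : ψ = convolution η χ (ContinuousLinearMap.lsmul ℝ ℝ) volume := rfl
  have hint : ∀ x, Integrable (fun z => η z * χ (x - z)) volume := fun x => by
    refine hηint.mul_bdd (c := 1) (hχ.comp (by fun_prop)).aestronglyMeasurable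
      (.of_forall fun z => ?_)
    rw [Real.norm_of_nonneg (h01 _).1]; exact (h01 _).2
  have hsmooth : ContDiff ℝ ∞ ψ := by
    rw [hconv]
    exact HasCompactSupport.contDiff_convolution_left _ b.hasCompactSupport_normed b.contDiff_normed
      hχ.locallyIntegrable
  have hψsupp : ∀ x, ρ + 1 < ‖x‖ → ψ x = 0 := fun x hx => by
    refine integral_eq_zero_of_ae (.of_forall fun z => ?_)
    by_cases hz : δ ≤ ‖z‖
    · simp [hηsupp z hz]
    · have : ρ < ‖x - z‖ := by
        have := norm_sub_norm_le x z
        linarith [not_le.1 hz]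
      simp [hsupp _ this]
  -- η is a probability density supported in the δ-ball, so averages against it inherit bounds valid
  -- there.
  have hbound : ∀ (F : Coord n → ℝ) (A : ℝ), (∀ z, ‖z‖ < δ → |F z| ≤ A) →
      |∫ z, η z * F z| ≤ A := fun F A hF => by
    have h1 : |∫ z, η z * F z| ≤ ∫ z, η z * A := by
      rw [← Real.norm_eq_abs]
      refine norm_integral_le_of_norm_le (hηint.mul_const A) (ae_of_all _ fun z => ?_)
      rw [norm_mul, Real.norm_of_nonneg (hη0 z)]
      by_cases hz : δ ≤ ‖z‖
      · simp [hηsupp z hz]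
      · exact mul_le_mul_of_nonneg_left (hF z (not_le.1 hz)) (hη0 z)
    rwa [integral_mul_const, hη1, one_mul] at h1
  have hdiff : ∀ x y, ψ x - ψ y = ∫ z, η z * (χ (x - z) - χ (y - z)) := fun x y => by
    simp only [hψ, mul_sub]
    rw [integral_sub (hint x) (hint y)]
  refine ⟨ψ, hsmooth, HasCompactSupport.intro (isCompact_closedBall 0 (ρ + 1))
    fun x hx => hψsupp x (by simpa using hx), fun x => ⟨?_, ?_⟩, fun x => ?_, fun x => ?_⟩
  · exact integral_nonneg fun z => mul_nonneg (hη0 z) (h01 _).1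
  · refine (le_abs_self _).trans (hbound _ _ fun z _ => ?_)
    rw [abs_of_nonneg (h01 _).1]; exact (h01 _).2
  · have : ψ x - χ x = ∫ z, η z * (χ (x - z) - χ x) := by
      simp only [hψ, mul_sub]
      rw [integral_sub (hint x) (hηint.mul_const _), integral_mul_const, hη1, one_mul]
    rw [this]
    refine hbound _ _ fun z hz => ?_
    have := hunif (a := x - z) (b := x) (by simpa using hz.trans_le hδδ₂)
    rw [Real.dist_eq] at this
    exact this.le
  · refine g.ip_grad_self_le (by positivity) fun v => ?_
    have hline : HasDerivAt (fun t : ℝ => ψ (x + t • v)) (fderiv ℝ ψ x v) 0 := by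
      have h1 : HasDerivAt (fun t : ℝ => x + t • v) ((1 : ℝ) • v) 0 :=
        ((hasDerivAt_id (0 : ℝ)).smul_const v).const_add x
      have h2 := (hsmooth.differentiable (by simp) (x + (0 : ℝ) • v)).hasFDerivAt
      have := h2.comp_hasDerivAt (0 : ℝ) h1
      rw [one_smul, zero_smul, add_zero] at this
      exact this
    by_cases hx : ‖x‖ ≤ ρ + 1
    swap
    · have hev : ψ =ᶠ[𝓝 x] fun _ => 0 := by
        filter_upwards [(isOpen_lt continuous_const continuous_norm).mem_nhds (not_le.1 hx)] with y hy
          using hψsupp y hy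
      rw [hev.fderiv_eq, fderiv_fun_const]
      simp only [Pi.zero_apply, zero_apply, abs_zero]
      positivity
    rw [← hline.deriv, ← Real.norm_eq_abs]
    refine norm_deriv_le_of_lip' (by positivity) ?_
    have hsmall : ∀ᶠ t in 𝓝 (0 : ℝ), ‖t • v‖ < δ := by
      have : Continuous fun t : ℝ => ‖t • v‖ := by fun_prop
      exact (this.tendsto 0).eventually_lt_const (by simpa using hδ0)
    filter_upwards [hsmall] with t ht
    rw [zero_smul, add_zero, sub_zero, Real.norm_eq_abs, Real.norm_eq_abs, hdiff]
    refine hbound _ _ fun z hz => ?_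
    -- The segment from x - z to x - z + tv stays near x, so its length is at most √4 = 2 times the
    -- length of tv measured at x.
    refine (hlip _ _ (2 * √(g.ip x (t • v) (t • v))) (by positivity) ?_).trans (le_of_eq ?_)
    · rw [g.edist_comm]
      refine g.edist_le_of_segment fun s hs => ?_
      have he : x + t • v - z - (x - z) = t • v := by abel
      rw [he]
      have hn : ‖x - z + s • t • v - x‖ < δ₁ := by
        have : x - z + s • t • v - x = s • t • v - z := by abel
        rw [this]
        have h1 := norm_sub_le (s • t • v) z
        have h2 : ‖s • t • v‖ ≤ ‖t • v‖ := by
          rw [norm_smul s, Real.norm_of_nonneg hs.1]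
          exact mul_le_of_le_one_left (norm_nonneg _) hs.2
        linarith
      have := Real.sqrt_le_sqrt (hcomp x (by simpa using hx) _ hn (t • v))
      rwa [Real.sqrt_mul (by norm_num), show √(4 : ℝ) = 2 by
        rw [show (4 : ℝ) = 2 ^ 2 by norm_num, Real.sqrt_sq (by norm_num)]] at this
    · rw [g.sqrt_ip_smul]; ring

/-- Complete manifolds have smooth compactly supported cutoff functions with small gradient. -/
lemma IsComplete.exists_cutoff {g : RiemannianStructure n} (hg : g.IsComplete) (r : ℝ) {ε : ℝ}
    (hε : 0 < ε) :
    ∃ ψ : Coord n → ℝ, ContDiff ℝ ∞ ψ ∧ HasCompactSupport ψ ∧ (∀ x, ψ x ∈ Icc (0 : ℝ) 1) ∧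
      (∀ x ∈ Metric.closedBall (0 : Coord n) r, |ψ x - 1| ≤ ε) ∧
      ∀ x, g.ip x (g.grad ψ x) (g.grad ψ x) ≤ ε ^ 2 := by
  obtain ⟨D, hD⟩ := (isCompact_closedBall (0 : Coord n) r).exists_bound_of_continuousOn
    g.continuous_radius.continuousOn
  -- L ≥ D makes the cutoff equal to 1 on the given ball; L ≥ 2/ε brings the gradient bound 2/L,
  -- doubled by mollification, below ε.
  set L : ℝ := max (max D 1) (2 / ε) with hL
  have hL1 : 1 ≤ L := (le_max_right _ _).trans (le_max_left _ _)
  have hL0 : 0 < L := one_pos.trans_le hL1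
  have hLD : D ≤ L := (le_max_left _ _).trans (le_max_left _ _)
  have hLε : 2 * L⁻¹ ≤ ε := by
    have : 2 / ε ≤ L := le_max_right _ _
    rw [div_le_iff₀ hε] at this
    rw [← div_eq_mul_inv, div_le_iff₀ hL0]; linarith
  set χ : Coord n → ℝ := fun x => max 0 (min 1 (2 - L⁻¹ * g.radius x)) with hχ
  have hcont : Continuous χ := by
    have := g.continuous_radius
    fun_prop
  -- Completeness enters here: χ vanishes where the geodesic radius is at least 2L, and the geodesic
  -- ball of that radius is bounded.
  obtain ⟨ρ, hρ⟩ := (hg (2 * L).toNNReal).subset_closedBall 0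
  have hsupp : ∀ x, ρ < ‖x‖ → χ x = 0 := fun x hx => by
    have hx' : x ∉ {x : Coord n | g.edist 0 x ≤ ((2 * L).toNNReal : ℝ≥0∞)} := fun h => by
      have := hρ h
      rw [mem_closedBall_zero_iff] at this
      linarith
    have h2 : 2 * L ≤ g.radius x := by
      rw [mem_ofPred_eq, not_le] at hx'
      have := ENNReal.toReal_mono (g.edist_ne_top 0 x) hx'.le
      rwa [ENNReal.coe_toReal, Real.coe_toNNReal _ (by positivity)] at this
    have h3 : 2 ≤ L⁻¹ * g.radius x := by
      rw [inv_mul_eq_div, le_div_iff₀ hL0]; exact h2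
    exact max_eq_left ((min_le_right _ _).trans (by linarith))
  have hlip : ∀ x y : Coord n, ∀ D, 0 ≤ D → g.edist x y ≤ ENNReal.ofReal D →
      |χ x - χ y| ≤ L⁻¹ * D := fun x y D hD h => by
    have h1 := g.abs_radius_sub_le hD h
    calc |χ x - χ y| ≤ |min 1 (2 - L⁻¹ * g.radius x) - min 1 (2 - L⁻¹ * g.radius y)| := by
          simp only [hχ, max_comm (0 : ℝ)]
          exact abs_max_sub_max_le_abs _ _ _
      _ ≤ |(2 - L⁻¹ * g.radius x) - (2 - L⁻¹ * g.radius y)| := by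
          simp only [min_comm (1 : ℝ)]
          exact (abs_min_sub_min_le_max _ _ _ _).trans (by simp)
      _ = L⁻¹ * |g.radius x - g.radius y| := by
          rw [show (2 - L⁻¹ * g.radius x) - (2 - L⁻¹ * g.radius y)
            = L⁻¹ * -(g.radius x - g.radius y) by ring, abs_mul, abs_neg,
            abs_of_nonneg (inv_nonneg.2 hL0.le)]
      _ ≤ L⁻¹ * D := mul_le_mul_of_nonneg_left h1 (inv_nonneg.2 hL0.le)
  obtain ⟨ψ, h1, h2, h3, h4, h5⟩ := g.exists_mollification hcont
    (fun x => ⟨le_max_left _ _, max_le zero_le_one (min_le_left _ _)⟩) hsupp (inv_nonneg.2 hL0.le)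
    hlip hε
  refine ⟨ψ, h1, h2, h3, fun x hx => ?_, fun x => (h5 x).trans ?_⟩
  · have hr : g.radius x ≤ L := ((le_abs_self _).trans (hD x hx)).trans hLD
    have hr' : L⁻¹ * g.radius x ≤ 1 := by
      rw [inv_mul_eq_div, div_le_one hL0]; exact hr
    have hχ1 : χ x = 1 := by
      simp only [hχ]
      rw [min_eq_left (by linarith), max_eq_right zero_le_one]
    rw [← hχ1]; exact h4 x
  · exact pow_le_pow_left₀ (by positivity) hLε 2

lemma grad_mul_apply {a b : Coord n → ℝ} {x : Coord n} (ha : DifferentiableAt ℝ a x)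
    (hb : DifferentiableAt ℝ b x) :
    g.grad (fun y => a y * b y) x = a x • g.grad b x + b x • g.grad a x := by
  refine g.eq_of_forall_ip_eq (x := x) fun v => ?_
  rw [g.ip_add_right, g.ip_smul_right, g.ip_smul_right, g.ip_grad, g.ip_grad, g.ip_grad,
    fderiv_fun_mul ha hb]
  simp

/-- R arctan(u/R) is a smooth bounded truncation of u whose gradient is grad u times a factor in (0,
1] that tends to 1 as R grows. -/
lemma grad_arctan_apply {u : Coord n → ℝ} {x : Coord n} (hu : DifferentiableAt ℝ u x) {R : ℝ}
    (hR : 0 < R) :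
    g.grad (fun y => R * Real.arctan (u y / R)) x = (1 / (1 + (u x / R) ^ 2)) • g.grad u x := by
  refine g.eq_of_forall_ip_eq (x := x) fun v => ?_
  have h := ((hu.hasFDerivAt.mul_const R⁻¹).arctan).const_mul R
  simp only [← div_eq_mul_inv] at h
  rw [g.ip_smul_right, g.ip_grad, g.ip_grad, h.fderiv]
  simp only [smul_apply, smul_eq_mul]
  field_simp

/-- On a complete manifold, the gradient of a smooth function is tangent if it is square
integrable. -/
lemma IsComplete.mk_grad_mem_tangentSpace {g : RiemannianStructure n} (hg : g.IsComplete)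
    (q : Measure (Coord n)) [IsFiniteMeasure q] {u : Coord n → ℝ} (hu : ContDiff ℝ ∞ u)
    (hgrad : g.MemL2 q (g.grad u)) : L2Field.mk _ hgrad ∈ tangentSpace g q := by
  have hR0 : ∀ k : ℕ, (0 : ℝ) < k + 1 := fun k => by positivity
  -- The truncation T k is of size at most 2(k + 1); the square in ε makes T k times grad (ψ k)
  -- still tend to 0.
  have hex := fun k : ℕ => hg.exists_cutoff k (ε := 1 / ((k : ℝ) + 1) ^ 2) (by positivity)
  choose ψ hψs hψc hψ01 hψ1 hψg using hex
  set T : ℕ → Coord n → ℝ := fun k y => ((k : ℝ) + 1) * Real.arctan (u y / (k + 1)) with hT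
  have hTs : ∀ k, ContDiff ℝ ∞ (T k) := fun k =>
    contDiff_const.mul (Real.contDiff_arctan.comp (hu.div_const _))
  set f : ℕ → Coord n → ℝ := fun k y => ψ k y * T k y with hf
  have hfs : ∀ k, ContDiff ℝ ∞ (f k) := fun k => (hψs k).mul (hTs k)
  have hfc : ∀ k, HasCompactSupport (f k) := fun k => (hψc k).mul_right
  -- a k is the coefficient of grad u in the error. It tends to 0 pointwise with |a k| ≤ 1, which
  -- allows dominated convergence with majorant 2 g(grad u, grad u) + 8.
  set a : ℕ → Coord n → ℝ := fun k x => ψ k x * (1 / (1 + (u x / (k + 1)) ^ 2)) - 1 with ha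
  have hsub : ∀ k x, g.grad (f k) x - g.grad u x = a k x • g.grad u x + T k x • g.grad (ψ k) x := by
    intro k x
    rw [hf, g.grad_mul_apply ((hψs k).differentiable (by simp) x) ((hTs k).differentiable (by simp) x),
      hT, g.grad_arctan_apply (hu.differentiable (by simp) x) (hR0 k), ha]
    module
  have hfrac : ∀ k x, 1 / (1 + (u x / ((k : ℝ) + 1)) ^ 2) ∈ Icc (0 : ℝ) 1 := fun k x =>
    ⟨by positivity, by rw [div_le_one (by positivity)]; nlinarith [sq_nonneg (u x / ((k : ℝ) + 1))]⟩
  have ha1 : ∀ k x, a k x ^ 2 ≤ 1 := fun k x => by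
    have h1 := mul_nonneg (hψ01 k x).1 (hfrac k x).1
    have h2 := mul_le_one₀ (hψ01 k x).2 (hfrac k x).1 (hfrac k x).2
    rw [sq_le_one_iff_abs_le_one, abs_le]
    constructor <;> simp only [ha] <;> linarith
  have hT1 : ∀ k x, T k x ^ 2 * g.ip x (g.grad (ψ k) x) (g.grad (ψ k) x)
      ≤ 4 * (1 / ((k : ℝ) + 1)) ^ 2 := fun k x => by
    have h1 : T k x ^ 2 ≤ (2 * ((k : ℝ) + 1)) ^ 2 := by
      refine sq_le_sq' ?_ ?_ <;> simp only [hT]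
      · nlinarith [Real.neg_pi_div_two_lt_arctan (u x / ((k : ℝ) + 1)), Real.pi_lt_four, hR0 k]
      · nlinarith [Real.arctan_lt_pi_div_two (u x / ((k : ℝ) + 1)), Real.pi_lt_four, hR0 k]
    calc _ ≤ (2 * ((k : ℝ) + 1)) ^ 2 * (1 / ((k : ℝ) + 1) ^ 2) ^ 2 :=
          mul_le_mul h1 (hψg k x) (g.ip_self_nonneg _ _) (by positivity)
      _ = _ := by have := (hR0 k).ne'; field_simp; norm_num
  set E : ℕ → Coord n → ℝ := fun k x =>
    g.ip x (g.grad (f k) x - g.grad u x) (g.grad (f k) x - g.grad u x) with hE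
  have hEle : ∀ k x, E k x ≤ 2 * (a k x ^ 2 * g.ip x (g.grad u x) (g.grad u x))
      + 8 * (1 / ((k : ℝ) + 1)) ^ 2 := fun k x => by
    have h := g.ip_add_self_le x (a k x • g.grad u x) (T k x • g.grad (ψ k) x)
    rw [← hsub] at h
    simp only [g.ip_smul_left, g.ip_smul_right] at h
    have := hT1 k x
    simp only [hE]
    nlinarith
  have hE0 : ∀ k x, 0 ≤ E k x := fun k x => g.ip_self_nonneg _ _
  have hone : Tendsto (fun k : ℕ => 1 / ((k : ℝ) + 1)) atTop (𝓝 0) :=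
    tendsto_one_div_add_atTop_nhds_zero_nat
  have halim : ∀ x, Tendsto (fun k => a k x) atTop (𝓝 0) := fun x => by
    have h1 : Tendsto (fun k => ψ k x) atTop (𝓝 1) := by
      rw [tendsto_iff_norm_sub_tendsto_zero]
      have hsq : Tendsto (fun k : ℕ => 1 / ((k : ℝ) + 1) ^ 2) atTop (𝓝 0) := by
        simpa [div_pow] using hone.pow 2
      refine squeeze_zero' (.of_forall fun _ => norm_nonneg _) ?_ hsq
      obtain ⟨N, hN⟩ := exists_nat_ge ‖x‖
      filter_upwards [eventually_ge_atTop N] with k hk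
      refine hψ1 k x ?_
      rw [mem_closedBall_zero_iff]
      exact hN.trans (by exact_mod_cast hk)
    have h2 : Tendsto (fun k : ℕ => 1 / (1 + (u x / ((k : ℝ) + 1)) ^ 2)) atTop (𝓝 1) := by
      have h3 : Tendsto (fun k : ℕ => u x / ((k : ℝ) + 1)) atTop (𝓝 0) := by
        simpa [div_eq_mul_inv] using hone.const_mul (u x)
      have h4 := ((h3.pow 2).const_add 1).inv₀ (by norm_num)
      simpa using h4
    simpa [ha] using (h1.mul h2).sub_const 1
  have hElim : ∀ x, Tendsto (fun k => E k x) atTop (𝓝 0) := fun x => by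
    refine squeeze_zero (fun k => hE0 k x) (fun k => hEle k x) ?_
    have h1 := ((((halim x).pow 2).mul_const (g.ip x (g.grad u x) (g.grad u x))).const_mul 2).add
      ((hone.pow 2).const_mul 8)
    simpa using h1
  have hmem := fun k => g.memL2_grad q (hfs k) (hfc k)
  have hEint : Tendsto (fun k => ∫ x, E k x ∂q) atTop (𝓝 0) := by
    have h := tendsto_integral_of_dominated_convergence (μ := q) (F := E) (f := fun _ => 0)
      (fun x => 2 * g.ip x (g.grad u x) (g.grad u x) + 8)
      (fun k => g.aestronglyMeasurable_ip ((hmem k).1.sub hgrad.1) ((hmem k).1.sub hgrad.1))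
      ((hgrad.2.const_mul 2).add (integrable_const 8))
      (fun k => .of_forall fun x => ?_) (.of_forall hElim)
    · simpa using h
    · rw [Real.norm_of_nonneg (hE0 k x)]
      refine (hEle k x).trans (add_le_add ?_ ?_)
      · have := mul_le_of_le_one_left (g.ip_self_nonneg x (g.grad u x)) (ha1 k x)
        linarith
      · have h1 : 1 / ((k : ℝ) + 1) ≤ 1 := by
          rw [div_le_one (hR0 k)]; linarith [Nat.cast_nonneg (α := ℝ) k]
        have h2 : (1 / ((k : ℝ) + 1)) ^ 2 ≤ 1 := pow_le_one₀ (by positivity) h1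
        linarith
  have hnorm : ∀ k, ‖L2Field.mk _ (hmem k) - L2Field.mk _ hgrad‖ ^ 2 = ∫ x, E k x ∂q := fun k => by
    rw [L2Field.norm_sq_eq]
    refine integral_congr_ae ?_
    filter_upwards [L2Field.fn_sub (L2Field.mk _ (hmem k)) (L2Field.mk _ hgrad),
      L2Field.fn_mk _ (hmem k), L2Field.fn_mk _ hgrad] with x h1 h2 h3
    rw [h1, Pi.sub_apply, h2, h3]
  have hlim : Tendsto (fun k => L2Field.mk _ (hmem k)) atTop (𝓝 (L2Field.mk _ hgrad)) := by
    rw [tendsto_iff_norm_sub_tendsto_zero]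
    have h := hEint.sqrt
    simp only [← hnorm, Real.sqrt_sq (norm_nonneg _), Real.sqrt_zero] at h
    exact h
  refine (Submodule.isClosed_topologicalClosure _).mem_of_tendsto hlim (.of_forall fun k => ?_)
  exact mem_tangentSpace_of_grad (hfs k) (hfc k) (L2Field.fn_mk _ (hmem k))

end RiemannianStructure

end WassersteinPoisson

/-! ### Hamiltonian vectors on the space of probability measures. -/

namespace WassersteinPoisson

variable {n : ℕ} {g : RiemannianStructure n} {β : PoissonStructure n}
  {q : ProbabilityMeasure (Coord n)}

/-- If `u` generates a linearization of `F` at `q`, then the Hamiltonian vectors of `F` at `q` are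
the projections of the Hamiltonian vector field of `u`. -/
lemma isHamiltonianVectorAt_iff {F : ProbabilityMeasure (Coord n) → ℝ} {u : Coord n → ℝ}
    (hF : IsLinearizationAt g F q u) (hX : g.MemL2 q (β.coordField u))
    (V : L2Field g (q : Measure (Coord n))) :
    IsHamiltonianVectorAt g β F q V ↔ V = tangentProj g q (L2Field.mk (β.coordField u) hX) := by
  have hbr : ∀ f x, g.ip x (g.grad f x) (β.coordField u x) = β.bracket f u x := fun f x => by
    rw [g.ip_grad_left, β.fderiv_coordField]
  constructor
  · rintro ⟨-, hV, h⟩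
    -- For a test function f, the function F_f is its own linearization, so V pairs with grad f to
    -- E_q[{f, u}], the pairing of grad f with X_u.
    refine eq_of_forall_inner_grad hV (tangentProj_mem g _ _) fun f Y hf hc hY => ?_
    have hmem := g.memL2_grad (q : Measure (Coord n)) hf hc
    have hYmk : Y = L2Field.mk _ hmem := L2Field.ext_fn (hY.trans (L2Field.fn_mk _ hmem).symm)
    have hYt := mem_tangentSpace_of_grad hf hc hY
    have hint : Integrable f (q : Measure (Coord n)) :=
      hf.continuous.integrable_of_hasCompactSupport hc
    have hG : HasGradientAt g (linearFunctional f) q Y := by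
      rw [hYmk] at hYt ⊢
      exact hasGradientAt_linearFunctional hf hint hmem hYt
    have hbint : Integrable (β.bracket f u) (q : Measure (Coord n)) :=
      (hmem.integrable_ip hX).congr (.of_forall fun x => hbr f x)
    rw [h _ Y _ hG ⟨f, u, ⟨hf, hint, Y, hG, hG⟩, hF, hbint, rfl⟩, inner_tangentProj hYt, inner_mk]
    refine integral_congr_ae ?_
    filter_upwards [hY] with x hx
    rw [hx, hbr]
  · rintro rfl
    refine ⟨⟨u, hF⟩, tangentProj_mem g _ _, ?_⟩
    -- The bracket may come from another linearization h of F. Uniqueness of gradients gives grad h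
    -- = grad u almost everywhere, hence dh = du and the same bracket with f.
    rintro G w c hG ⟨f, h, ⟨hf, hfi, v, hGv, hfv⟩, ⟨hh, hhi, z, hFz, hhz⟩, -, rfl⟩
    obtain ⟨hu, hui, z', hFz', huz⟩ := hF
    obtain rfl := hG.unique hGv
    obtain rfl := hFz.unique hFz'
    rw [inner_tangentProj hG.1, inner_mk]
    refine integral_congr_ae ?_
    filter_upwards [hfv.fn_ae_eq_grad hf hfi, hhz.fn_ae_eq_grad hh hhi,
      huz.fn_ae_eq_grad hu hui] with x h1 h2 h3
    have hd : fderiv ℝ h x = fderiv ℝ u x := by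
      ext1 v
      rw [← g.ip_grad, ← g.ip_grad, ← h2, h3]
    rw [h1, hbr]
    simp only [PoissonStructure.bracket, partialDeriv, hd]

/-- The Kullback-Leibler divergence is linearized by the log-density ratio. -/
lemma isLinearizationAt_KL {p : ProbabilityMeasure (Coord n)} {ρp ρq : Coord n → ℝ}
    (hp : IsSmoothPosDensity p ρp) (hq : IsSmoothPosDensity q ρq)
    (hKL : InformationTheory.klDiv (q : Measure (Coord n)) (p : Measure (Coord n)) ≠ ⊤)
    (hgrad : g.MemL2 q (g.grad fun x => Real.log (ρq x / ρp x)))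
    (htan : L2Field.mk _ hgrad ∈ tangentSpace g (q : Measure (Coord n))) :
    IsLinearizationAt g (KL p) q fun x => Real.log (ρq x / ρp x) := by
  have hu := hp.contDiff_log_div hq
  have hui := hp.integrable_log_div hq hKL
  refine ⟨hu, hui, L2Field.mk _ hgrad, ⟨htan, fun φ => ?_⟩,
    hasGradientAt_linearFunctional hu hui hgrad htan⟩
  rw [inner_mk_grad_tangentVector hgrad htan]
  exact hp.hasDerivAt_KL_curve hq hKL φ

end WassersteinPoisson

open WassersteinPoisson
theorem lemma2 {n : ℕ} (g : RiemannianStructure n) (β : PoissonStructure n)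
    (p q : ProbabilityMeasure (Coord n)) (ρp ρq : Coord n → ℝ)
    (hp : IsSmoothPosDensity p ρp) (hq : IsSmoothPosDensity q ρq)
    (hKL : InformationTheory.klDiv (q : Measure (Coord n)) (p : Measure (Coord n)) ≠ ⊤)
    (hgrad : g.MemL2 q (g.grad fun x => Real.log (ρq x / ρp x)))
    (htan : g.IsComplete ∨ L2Field.mk _ hgrad ∈ tangentSpace g q)
    (hX : g.MemL2 q (β.coordField fun x => Real.log (ρq x / ρp x))) :
    β.IsHamiltonianField (fun x => Real.log (ρq x / ρp x))
        (β.coordField fun x => Real.log (ρq x / ρp x)) ∧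
      ∀ V : L2Field g (q : Measure (Coord n)),
        IsHamiltonianVectorAt g β (KL p) q V ↔
          V = tangentProj g q
            (L2Field.mk (β.coordField fun x => Real.log (ρq x / ρp x)) hX) := by
  refine ⟨fun h _ x => β.fderiv_coordField _ h x, fun V => ?_⟩
  -- Completeness is used only to obtain tangency of the gradient, so both alternatives merge here.
  have ht : L2Field.mk _ hgrad ∈ tangentSpace g (q : Measure (Coord n)) :=
    htan.elim (fun hc => hc.mk_grad_mem_tangentSpace q (hp.contDiff_log_div hq) hgrad) id
  exact isHamiltonianVectorAt_iff (isLinearizationAt_KL hp hq hKL hgrad ht) hX V
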